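/- Let $g\ge 1$, and let $\pi_1=\pi_1(\Sigma_{g,1},p)$ be the fundamental group of the compact oriented surface of genus $g$ with one boundary component, based at a point $p$ of the boundary. It is free on standard generators $a_1,b_1,\dots,a_g,b_g$ for which the class of the boundary is $\partial=\prod_{i=1}^{g}[a_i,b_i]$, where $[a,b]=aba^{-1}b^{-1}$. A *fatgraph* is a finite connected graph with a cyclic ordering of the oriented edges pointing to each vertex. Write $\bar e$ for the oriented edge $e$ with reversed orientation. A *boundary cycle* is a cycle of the permutation that sends an oriented edge $e$ to $\bar f$, where $f$ follows $e$ in the cyclic ordering at the vertex to which $e$ points. A fatgraph with $n$ boundary cycles has genus $g$ if its Euler characteristic is $2-2g-n$. A *bordered fatgraph* is a fatgraph with exactly one boundary cycle in which all vertices have valence at least $3$ except for a unique univalent vertex. Let $t$ (the *tail*) be its oriented edge that points away from the univalent vertex. The boundary cycle, started at $t$, orders all oriented edges linearly, and the *preferred orientation* of an edge is the smaller of its two orientations. A *marking* of a bordered fatgraph $G$ of genus $g$ is a map $m$ from its oriented edges to $\pi_1$ such that $m(e)m(\bar e)=1$ for every oriented edge $e$; $m(e_1)\cdots m(e_k)=1$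 whenever $e_1,\dots,e_k$ are the cyclically ordered oriented edges pointing to a vertex other than the univalent one; the image of $m$ generates $\pi_1$; and $m(\bar t)=\partial$. The *greedy tree* $T_G$ consists of the edges whose preferred orientation $e$ satisfies $e\le x$ for every oriented edge $x$ pointing to the same vertex as $e$. The *greedy generating set* $\mathbf X_G\subset\pi_1$ is the set of all $m(e)$, where $e$ runs over the preferred orientations of the edges not in $T_G$. **Proposition.** Let $\mathbf X=\{x_1,\dots,x_{2g}\}$ be a set of $2g$ generators of $\pi_1$. 1. The following are equivalent: (a) after replacing some of the $x_i$ by their inverses, $\mathbf X$ becomes the greedy generating set $\mathbf X_G$ of some marked bordered fatgraph $G$ of genus $g$; (b) $\partial$ can be written as a reduced word in the letters $x_1^{\pm1},\dots,x_{2g}^{\pm1}$ that contains each $x_i$ and each $x_i^{-1}$ exactly once. 2. The set of replacements in (a) is unique: if inverting the $x_i$ with $i\in S$, and likewise inverting the $x_i$ with $i\in S'$, both give greedy generating sets of (possibly different) marked bordered fatgraphs of genus $g$, then $S=S'$. 3. The set of replacements is computable: there is an algorithm (a total computable function, the same for all $g$) which, given $g$ and words in the letters $a_i^{\pm1},b_i^{\pm1}$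 representing $x_1,\dots,x_{2g}$ for which (a) holds, outputs the set of those $i$ for which $x_i$ has to be inverted. -/

import Mathlib

/-! ### The fundamental group of the surface with one boundary component

Cutting the compact oriented surface of genus `g` with one boundary component along the standard
system of loops based at a boundary point shows that its fundamental group is free on the
`2 * g` classes `a₁, b₁, …, a_g, b_g`, with the boundary representing `[a₁,b₁] ⋯ [a_g,b_g]`. -/

/-- The fundamental group of the genus `g` surface with one boundary component: the free group on
the standard loops `aᵢ`, encoded as `(i, false)`, and `bᵢ`, encoded as `(i, true)`. -/
abbrev SurfaceGroup (g : ℕ) : Type := FreeGroup (Fin g × Bool)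

/-- The class of the boundary, `[a₁,b₁] [a₂,b₂] ⋯ [a_g,b_g]` where `[a,b] = a b a⁻¹ b⁻¹`. -/
def boundaryClass (g : ℕ) : SurfaceGroup g :=
  ((List.finRange g).map fun i =>
    (FreeGroup.of (i, false) * FreeGroup.of (i, true) *
      (FreeGroup.of (i, false))⁻¹ * (FreeGroup.of (i, true))⁻¹ : SurfaceGroup g)).prod

/-! ### Fatgraphs -/

/-- A fatgraph: a finite connected graph with a cyclic ordering of the oriented edges pointing to
each vertex. It is given by its set of oriented edges, the reversal `bar` of orientation, and the
permutation `nxt` that sends an oriented edge `e` to its successor in the cyclic ordering at the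
vertex to which `e` points. The vertices are the cycles of `nxt`. -/
structure Fatgraph where
  /-- oriented edges -/
  OrEdge : Type
  finite : Finite OrEdge
  /-- reversal of orientation -/
  bar : Equiv.Perm OrEdge
  bar_bar : ∀ e, bar (bar e) = e
  bar_ne : ∀ e, bar e ≠ e
  /-- successor in the cyclic ordering of the oriented edges pointing to the same vertex -/
  nxt : Equiv.Perm OrEdge
  connected : ∀ e f : OrEdge, ∃ p ∈ Subgroup.closure {bar, nxt}, p e = f

namespace Fatgraph

variable (G : Fatgraph)

/-- The vertices. -/
def Vertex : Type := Quotient (Equiv.Perm.SameCycle.setoid G.nxt)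

/-- The vertex to which an oriented edge points. -/
def head (e : G.OrEdge) : G.Vertex := Quotient.mk (Equiv.Perm.SameCycle.setoid G.nxt) e

/-- The unoriented edges. -/
def Edge : Type := Quotient (Equiv.Perm.SameCycle.setoid G.bar)

/-- The successor of `e` along its boundary cycle: the next edge in the cyclic ordering at the
vertex to which `e` points, oriented so as to point away from that vertex. -/
def boundaryNext : Equiv.Perm G.OrEdge := G.nxt.trans G.bar

/-- The boundary cycles. -/
def BoundaryCycle : Type := Quotient (Equiv.Perm.SameCycle.setoid G.boundaryNext)

/-- The number of oriented edges pointing to a vertex. -/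
noncomputable def valence (v : G.Vertex) : ℕ := Nat.card {e : G.OrEdge // G.head e = v}

/-- `G` has genus `g`: its Euler characteristic is `2 - 2 g - n`, where `n` is the number of its
boundary cycles. -/
def HasGenus (g : ℕ) : Prop :=
  (Nat.card G.Vertex : ℤ) - Nat.card G.Edge = 2 - 2 * g - Nat.card G.BoundaryCycle

end Fatgraph

/-- A (once-)bordered fatgraph: there is only one boundary cycle, and all vertices are at least
trivalent except for a unique univalent vertex. The oriented edge `tail` is the one pointing away
from the univalent vertex. -/
structure BorderedFatgraph extends Fatgraph where
  one_boundary : Nat.card toFatgraph.BoundaryCycle = 1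
  tail : OrEdge
  valence_tail : toFatgraph.valence (toFatgraph.head (bar tail)) = 1
  valence_ge : ∀ v, v ≠ toFatgraph.head (bar tail) → 3 ≤ toFatgraph.valence v

namespace BorderedFatgraph

variable (G : BorderedFatgraph)

/-- The position of an oriented edge in the linear ordering of all oriented edges, in which they
are passed by the boundary cycle that starts at the univalent vertex. -/
noncomputable def pos (e : G.OrEdge) : ℕ := sInf {k : ℕ | (G.boundaryNext ^ k) G.tail = e}

/-- `e` is the preferred orientation of its underlying edge. -/
def Preferred (e : G.OrEdge) : Prop := G.pos e < G.pos (G.bar e)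

/-- The edge with preferred orientation `e` belongs to the greedy tree: `e` comes first among all
oriented edges pointing to the same vertex. -/
def InTree (e : G.OrEdge) : Prop :=
  G.Preferred e ∧ ∀ x : G.OrEdge, G.head x = G.head e → G.pos e ≤ G.pos x

/-- The generators of `G`: the edges outside the greedy tree, with their preferred orientations. -/
def generators : Set G.OrEdge := {e | G.Preferred e ∧ ¬ G.InTree e}

/-- A geometric marking of a bordered fatgraph by the fundamental group of the surface of genus `g`
with one boundary component. The vertex condition is imposed at all vertices but the univalent
one, for each choice `e` of the first edge in the cyclic ordering. -/
structure Marking (g : ℕ) where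
  /-- the element of the fundamental group attached to an oriented edge -/
  val : G.OrEdge → SurfaceGroup g
  edge : ∀ e, val e * val (G.bar e) = 1
  vertex : ∀ e, G.head e ≠ G.head (G.bar G.tail) →
    ((List.range (G.valence (G.head e))).map fun i => val ((G.nxt ^ i) e)).prod = 1
  surjective : Subgroup.closure (Set.range val) = ⊤
  geometric : val (G.bar G.tail) = boundaryClass g

end BorderedFatgraph

/-- The set `X` arises as the set of generators that the greedy algorithm attaches to a marked
bordered fatgraph of genus `g`. -/
def ArisesFromFatgraph {g : ℕ} (X : Set (SurfaceGroup g)) : Prop :=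
  ∃ (G : BorderedFatgraph) (_ : G.HasGenus g) (m : G.Marking g), X = m.val '' G.generators

/-- The tuple obtained from `x` by replacing `x i` with its inverse for those `i` with
`ε i = true`. -/
def invertAt {g : ℕ} (ε : Fin (2 * g) → Bool) (x : Fin (2 * g) → SurfaceGroup g) :
    Fin (2 * g) → SurfaceGroup g :=
  fun i => if ε i then (x i)⁻¹ else x i

/-- The boundary class can be written as a reduced word in the letters `x i` and `(x i)⁻¹`
(encoded as `(i, true)` and `(i, false)`) that contains each of these letters exactly once. -/
def BoundaryIsWord {g : ℕ} (x : Fin (2 * g) → SurfaceGroup g) : Prop :=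
  ∃ w : List (Fin (2 * g) × Bool), FreeGroup.IsReduced w ∧ (∀ l, w.count l = 1) ∧
    FreeGroup.lift x (FreeGroup.mk w) = boundaryClass g

/-- A tuple of words in the standard letters `aᵢ^{±1}`, `bᵢ^{±1}` as data for an algorithm that
takes all genera: the indices of the letters are read as natural numbers. -/
def encodeTuple {g : ℕ} (u : Fin (2 * g) → List ((Fin g × Bool) × Bool)) :
    List (List ((ℕ × Bool) × Bool)) :=
  List.ofFn fun i => (u i).map fun l => ((l.1.1.val, l.1.2), l.2)

/-!
# Generators of marked bordered fatgraphs and words for the boundary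

Free groups of finite rank are residually finite, hence Hopfian, so `2 * g` generators of the
surface group form a basis `x` (`FreeGroup.lift_bijective_of_closure_eq_top`).

**From fatgraphs to words.** Start at the tail and expand, in the order of the boundary cycle, each
edge of the greedy tree by the vertex relation at its end. This rewrites `∂` as the product of the
markings of all oriented edges outside the tree, each occurring once, in the order `w` in which a
walk around the tree meets them (`BorderedFatgraph.exists_list_offTree`). If `y` follows `u` on this
walk, the boundary cycle, after arriving through `u`, only runs along tree edges until it leaves
through `y` reversed. So the boundary order of the edges outside the tree, and with it their
preferred orientations, can be read off from `w` alone by a walk on the gaps between its letters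
(`BorderedFatgraph.preferred_iff_idxOf_gapTrace_lt`). As `w` is the reduced word for `∂` in the
basis `x`, the inversions are unique, and they are computed by an exhaustive search for `w` followed by
this walk (`findInversions`).

**From words to fatgraphs.** Arrange the tail and the letters of `w` around one interior vertex. The
loops of this graph are the generators, and the only point at issue is that there is one boundary
cycle. The boundary cycles are classes of gaps of `w`, and a locally constant function on them has
jumps which define a homomorphism from the surface group to `ℤ`. A computation in the Heisenberg
group, in which `∂` represents the symplectic form, shows that this homomorphism lies in the radical
of the form; hence it vanishes, and the function is constant (`GapInvariant.eq_zero_gap`). The same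
lemma shows that `w` is reduced, since the gap inside a cancelling pair of letters would be a class
of its own.
-/

/-! ### Free groups of finite rank are Hopfian -/

/-- A finite partial injection, given as a relation, extends to a permutation. -/
theorem exists_perm_of_biUnique {α : Type*} [Finite α] (r : α → α → Prop)
    (hl : ∀ x y z, r x y → r x z → y = z) (hr : ∀ x y z, r x z → r y z → x = y) :
    ∃ σ : Equiv.Perm α, ∀ x y, r x y → σ x = y := by
  classical
  have := Fintype.ofFinite α
  choose f hf using fun x : {x // ∃ y, r x y} => x.2
  let e : {x // ∃ y, r x y} ≃ {y // ∃ x, r x y} := Equiv.ofBijective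
    (fun x => ⟨f x, x.1, hf x⟩)
    ⟨fun x y h => Subtype.ext <| hr _ _ _ (hf x) <| by
        rw [show f x = f y from congrArg Subtype.val h]; exact hf y,
      fun y => by
        obtain ⟨y, x, h⟩ := y
        exact ⟨⟨x, y, h⟩, Subtype.ext (hl _ _ _ (hf ⟨x, y, h⟩) h)⟩⟩
  refine ⟨e.extendSubtype, fun x y h => ?_⟩
  rw [Equiv.extendSubtype_apply_of_mem e x ⟨y, h⟩]
  exact hl _ _ _ (hf ⟨x, y, h⟩) h

/-- A nontrivial element of a free group acts nontrivially in some finite permutation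
representation: let each generator move the prefixes of the reduced word as that word dictates. -/
theorem FreeGroup.exists_perm_rep_ne_one {α : Type*} (γ : FreeGroup α) (hγ : γ ≠ 1) :
    ∃ (n : ℕ) (ρ : FreeGroup α →* Equiv.Perm (Fin n)), ρ γ ≠ 1 := by
  classical
  obtain ⟨w, hw, rfl⟩ : ∃ w : List (α × Bool), FreeGroup.IsReduced w ∧ FreeGroup.mk w = γ :=
    ⟨γ.toWord, FreeGroup.isReduced_toWord, FreeGroup.mk_toWord⟩
  have hw0 : w ≠ [] := by rintro rfl; exact hγ rfl
  have hadj : ∀ j a b, w[j]? = some (a, b) → w[j + 1]? = some (a, !b) → False := by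
    intro j a b h1 h2
    rw [List.getElem?_eq_some_iff] at h1 h2
    obtain ⟨h1l, h1⟩ := h1
    obtain ⟨h2l, h2⟩ := h2
    have := List.isChain_iff_getElem.1 hw j h2l
    rw [h1, h2] at this
    simpa using this rfl
  let r : α → Fin (w.length + 1) → Fin (w.length + 1) → Prop := fun a x y =>
    (w[y.1]? = some (a, true) ∧ x.1 = y.1 + 1) ∨ (w[x.1]? = some (a, false) ∧ y.1 = x.1 + 1)
  have hσ : ∀ a, ∃ σ : Equiv.Perm (Fin (w.length + 1)), ∀ x y, r a x y → σ x = y := by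
    intro a
    apply exists_perm_of_biUnique
    · rintro x y z (⟨h1, h2⟩ | ⟨h1, h2⟩) (⟨h3, h4⟩ | ⟨h3, h4⟩)
      · ext; omega
      · rw [h2] at h3; exact (hadj _ _ _ h1 h3).elim
      · rw [h4] at h1; exact (hadj _ _ _ h3 h1).elim
      · ext; omega
    · rintro x y z (⟨h1, h2⟩ | ⟨h1, h2⟩) (⟨h3, h4⟩ | ⟨h3, h4⟩)
      · ext; omega
      · rw [h4] at h1; exact (hadj _ _ _ h3 h1).elim
      · rw [h2] at h3; exact (hadj _ _ _ h1 h3).elim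
      · ext; omega
  choose σ hσ using hσ
  have key : ∀ (v u : List (α × Bool)), w = u ++ v → ∀ (h : u.length < w.length + 1),
      FreeGroup.lift σ (FreeGroup.mk v) (Fin.last _) = ⟨u.length, h⟩ := by
    intro v
    induction v with
    | nil =>
      intro u hu h
      rw [← FreeGroup.one_eq_mk, _root_.map_one]
      simp [Fin.ext_iff, hu]
    | cons l v ih =>
      intro u hu h
      have h' : (u ++ [l]).length < w.length + 1 := by rw [hu]; simp
      have := ih (u ++ [l]) (by simp [hu]) h'
      rw [show l :: v = [l] ++ v from rfl, ← FreeGroup.mul_mk, _root_.map_mul,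
        Equiv.Perm.mul_apply, this]
      have hl : w[u.length]? = some l := by rw [hu]; simp
      obtain ⟨a, b⟩ := l
      cases b
      · simp only [FreeGroup.lift_mk, List.map_cons, List.map_nil, List.prod_cons, List.prod_nil,
          mul_one, cond_false]
        rw [Equiv.Perm.inv_eq_iff_eq]
        exact (hσ a _ _ (Or.inr ⟨hl, by simp⟩)).symm
      · simp only [FreeGroup.lift_mk, List.map_cons, List.map_nil, List.prod_cons, List.prod_nil,
          mul_one, cond_true]
        exact hσ a _ _ (Or.inl ⟨hl, by simp⟩)
  refine ⟨_, FreeGroup.lift σ, fun h1 => ?_⟩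
  have := key w [] rfl (by simp)
  rw [h1, Equiv.Perm.one_apply, Fin.ext_iff] at this
  simp only [Fin.val_last, List.length_nil, List.length_eq_zero_iff] at this
  exact hw0 this

/-- As many generators of a free group of finite rank as its rank form a basis. A surjective
endomorphism permutes the finitely many homomorphisms to a given finite group, so an element of its
kernel dies in every finite quotient. -/
theorem FreeGroup.lift_bijective_of_closure_eq_top {α β : Type*} [Finite β] (e : α ≃ β)
    (x : α → FreeGroup β) (hx : Subgroup.closure (Set.range x) = ⊤) :
    Function.Bijective (FreeGroup.lift x) := by
  have hsurj : Function.Surjective (FreeGroup.lift x) := by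
    rw [← MonoidHom.range_eq_top, FreeGroup.range_lift_eq_closure, hx]
  refine ⟨(injective_iff_map_eq_one _).2 fun γ hγ => ?_, hsurj⟩
  by_contra hne
  have := Finite.of_equiv _ e.symm
  obtain ⟨n, ρ, hρ⟩ := FreeGroup.exists_perm_rep_ne_one γ hne
  let T : (FreeGroup β →* Equiv.Perm (Fin n)) → (FreeGroup α →* Equiv.Perm (Fin n)) :=
    fun f => f.comp (FreeGroup.lift x)
  have hT : Function.Injective T := fun f f' h => by
    ext1 b
    obtain ⟨c, hc⟩ := hsurj (FreeGroup.of b)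
    rw [← hc]
    exact DFunLike.congr_fun h c
  let U : (FreeGroup β →* Equiv.Perm (Fin n)) ≃ (FreeGroup α →* Equiv.Perm (Fin n)) :=
    FreeGroup.lift.symm.trans ((e.symm.arrowCongr (Equiv.refl _)).trans FreeGroup.lift)
  have : Finite (FreeGroup β →* Equiv.Perm (Fin n)) := Finite.of_equiv _ FreeGroup.lift
  have hb : Function.Surjective (U.symm ∘ T) :=
    Finite.surjective_of_injective (U.symm.injective.comp hT)
  obtain ⟨f, hf⟩ := hb (U.symm ρ)
  have hf : T f = ρ := U.symm.injective hf
  apply hρ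
  rw [← hf]
  simp [T, hγ]

/-! ### The intersection form: words for the boundary have no invariant gap functions -/

/-- The integral Heisenberg group of upper unitriangular matrices `1 a c; 0 1 b; 0 0 1`. -/
@[ext]
structure Heisenberg where
  /-- the entry at position `(1, 2)` -/
  a : ℤ
  /-- the entry at position `(2, 3)` -/
  b : ℤ
  /-- the entry at position `(1, 3)` -/
  c : ℤ

namespace Heisenberg

instance : Mul Heisenberg := ⟨fun x y => ⟨x.a + y.a, x.b + y.b, x.c + y.c + x.a * y.b⟩⟩
instance : One Heisenberg := ⟨⟨0, 0, 0⟩⟩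
instance : Inv Heisenberg := ⟨fun x => ⟨-x.a, -x.b, -x.c + x.a * x.b⟩⟩

@[simp] theorem mul_a (x y : Heisenberg) : (x * y).a = x.a + y.a := rfl
@[simp] theorem mul_b (x y : Heisenberg) : (x * y).b = x.b + y.b := rfl
@[simp] theorem mul_c (x y : Heisenberg) : (x * y).c = x.c + y.c + x.a * y.b := rfl
@[simp] theorem one_a : (1 : Heisenberg).a = 0 := rfl
@[simp] theorem one_b : (1 : Heisenberg).b = 0 := rfl
@[simp] theorem one_c : (1 : Heisenberg).c = 0 := rfl
@[simp] theorem inv_a (x : Heisenberg) : x⁻¹.a = -x.a := rfl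
@[simp] theorem inv_b (x : Heisenberg) : x⁻¹.b = -x.b := rfl
@[simp] theorem inv_c (x : Heisenberg) : x⁻¹.c = -x.c + x.a * x.b := rfl

instance : Group Heisenberg := Group.ofLeftAxioms
  (fun x y z => by ext <;> simp <;> ring) (fun x => by ext <;> simp)
  (fun x => by ext <;> simp)

/-- The homomorphism that reads off the entry `a`. -/
def aHom : Heisenberg →* Multiplicative ℤ where
  toFun x := Multiplicative.ofAdd x.a
  map_one' := rfl
  map_mul' _ _ := rfl

theorem commutator_eq (x y : Heisenberg) :
    x * y * x⁻¹ * y⁻¹ = ⟨0, 0, x.a * y.b - y.a * x.b⟩ := by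
  ext <;> simp; ring

theorem prod_central {ι : Type*} (l : List ι) (d : ι → ℤ) :
    (l.map fun i => (⟨0, 0, d i⟩ : Heisenberg)).prod = ⟨0, 0, (l.map d).sum⟩ := by
  induction l with
  | nil => rfl
  | cons i l ih => rw [List.map_cons, List.prod_cons, ih]; ext <;> simp

end Heisenberg

/-- In the Heisenberg group the boundary class is seen as the value of the intersection form. -/
theorem map_boundaryClass_c {g : ℕ} (ρ : SurfaceGroup g →* Heisenberg) :
    (ρ (boundaryClass g)).c = ∑ i : Fin g,
      ((ρ (FreeGroup.of (i, false))).a * (ρ (FreeGroup.of (i, true))).b -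
        (ρ (FreeGroup.of (i, true))).a * (ρ (FreeGroup.of (i, false))).b) := by
  unfold boundaryClass
  rw [map_list_prod, List.map_map]
  simp only [Function.comp_def, map_mul, map_inv, Heisenberg.commutator_eq,
    Heisenberg.prod_central, Fin.sum_univ_def]

/-- The inverse of a letter. -/
def letterInv {α : Type*} (l : α × Bool) : α × Bool := (l.1, !l.2)

@[simp] theorem letterInv_letterInv {α : Type*} (l : α × Bool) : letterInv (letterInv l) = l := by
  simp [letterInv]

theorem letterInv_ne {α : Type*} (l : α × Bool) : letterInv l ≠ l := by
  intro h
  simpa [letterInv] using congrArg Prod.snd h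

/-- A function `S` on the gaps `0, …, n` of a word `w` of length `n` is invariant if it takes the
same value at the gap after a letter and at the gap before the inverse letter. The classes of gaps
generated by this rule are the boundary cycles of the fatgraph with one interior vertex, around
which the ends of the edges are arranged as in `w`. -/
def GapInvariant {α : Type*} [BEq α] {β : Type*} (w : List (α × Bool)) (S : ℕ → β) : Prop :=
  ∀ p l, w[p]? = some l → S (p + 1) = S (w.idxOf (letterInv l))

theorem List.Nodup.idxOf_eq {α : Type*} [BEq α] [LawfulBEq α] {l : List α} (h : l.Nodup)
    {i : ℕ} {a : α} (hi : l[i]? = some a) : l.idxOf a = i := by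
  rw [List.getElem?_eq_some_iff] at hi
  obtain ⟨hi, rfl⟩ := hi
  exact h.idxOf_getElem i hi

theorem List.getElem?_idxOf_of_mem {α : Type*} [BEq α] [LawfulBEq α] {l : List α} {a : α}
    (h : a ∈ l) :
    l[l.idxOf a]? = some a := by
  rw [List.getElem?_eq_some_iff]
  exact ⟨List.idxOf_lt_length_of_mem h, List.getElem_idxOf _⟩

theorem length_eq_of_nodup {g : ℕ} {w : List (Fin (2 * g) × Bool)} (hnd : w.Nodup)
    (hmem : ∀ l, l ∈ w) : w.length = 4 * g := by
  have h1 := List.toFinset_card_of_nodup hnd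
  rw [show w.toFinset = Finset.univ by ext l; simp [hmem l], Finset.card_univ,
    Fintype.card_prod, Fintype.card_fin, Fintype.card_bool] at h1
  omega

/-- If the boundary class is written in a basis as a word that contains each letter exactly once,
then the invariant functions on the gaps of the word are constant. Otherwise the jumps of such a
function define a nonzero cohomology class in the radical of the intersection form. -/
theorem GapInvariant.eq_zero_gap {g : ℕ} {x : Fin (2 * g) → SurfaceGroup g}
    (hx : Function.Bijective (FreeGroup.lift x)) {w : List (Fin (2 * g) × Bool)}
    (hnd : w.Nodup) (hmem : ∀ l, l ∈ w) (hw : FreeGroup.lift x (FreeGroup.mk w) = boundaryClass g)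
    {S : ℕ → ℤ} (hS : GapInvariant w S) : ∀ p ≤ w.length, S p = S 0 := by
  let e := MulEquiv.ofBijective (FreeGroup.lift x) hx
  let k : Fin (2 * g) → ℤ := fun i => S (w.idxOf (i, true) + 1) - S (w.idxOf (i, true))
  let φ : SurfaceGroup g →* Multiplicative ℤ :=
    (FreeGroup.lift fun i => Multiplicative.ofAdd (k i)).comp e.symm.toMonoidHom
  have hφx : ∀ i, φ (x i) = Multiplicative.ofAdd (k i) := by
    intro i
    have : e.symm (x i) = FreeGroup.of i := by
      rw [MulEquiv.symm_apply_eq]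
      simp [e]
    simp [φ, this]
  have hget : ∀ l, w[w.idxOf l]? = some l := fun l => List.getElem?_idxOf_of_mem (hmem l)
  have hS' : ∀ l, S (w.idxOf l + 1) = S (w.idxOf (letterInv l)) := fun l => hS _ _ (hget l)
  -- The Heisenberg representations with first entry `φ` and arbitrary second entry kill `∂`.
  have key : ∀ ψ : Fin g × Bool → ℤ, ∑ i : Fin g,
      ((φ (FreeGroup.of (i, false))).toAdd * ψ (i, true) -
        (φ (FreeGroup.of (i, true))).toAdd * ψ (i, false)) = 0 := by
    intro ψ
    let ρ : SurfaceGroup g →* Heisenberg :=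
      FreeGroup.lift fun c => ⟨(φ (FreeGroup.of c)).toAdd, ψ c, 0⟩
    have hρa : ∀ γ, (ρ γ).a = (φ γ).toAdd := by
      have : Heisenberg.aHom.comp ρ = φ := by
        ext c
        simp [ρ, Heisenberg.aHom]
      intro γ
      rw [← this]
      rfl
    have hc := map_boundaryClass_c ρ
    simp only [hρa] at hc
    simp only [ρ, FreeGroup.lift_apply_of] at hc
    rw [← hc, ← hw]
    change (ρ _).c = 0
    let A : Fin (2 * g) × Bool → Heisenberg := fun l => ρ (FreeGroup.lift x (FreeGroup.mk [l]))
    have hAt : ∀ i, A (i, true) = ρ (x i) := fun i => by simp [A, FreeGroup.lift_mk]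
    have hAf : ∀ i, A (i, false) = (ρ (x i))⁻¹ := fun i => by simp [A, FreeGroup.lift_mk]
    have hAa : ∀ l, (A l).a = S (w.idxOf l + 1) - S (w.idxOf l) := by
      rintro ⟨i, b⟩
      cases b
      · rw [hAf, Heisenberg.inv_a, hρa, hφx, hS']
        have := hS' (i, true)
        simp only [letterInv, Bool.not_true, Bool.not_false] at this ⊢
        rw [← this, toAdd_ofAdd]
        ring
      · rw [hAt, hρa, hφx, toAdd_ofAdd]
    let T : Fin (2 * g) × Bool → ℤ := fun l => (S (w.idxOf l) - S 0) * (A l).b + (A l).c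
    have hpre : ∀ u : List (Fin (2 * g) × Bool), u <+: w →
        (ρ (FreeGroup.lift x (FreeGroup.mk u))).a = S u.length - S 0 ∧
        (ρ (FreeGroup.lift x (FreeGroup.mk u))).c = (u.map T).sum := by
      intro u
      induction u using List.reverseRecOn with
      | nil =>
        intro _
        rw [← FreeGroup.one_eq_mk, map_one, map_one]
        simp
      | append_singleton u l ih =>
        intro hu
        obtain ⟨h1, h2⟩ := ih ((List.prefix_append _ _).trans hu)
        have hl : w.idxOf l = u.length := by
          apply hnd.idxOf_eq
          obtain ⟨v, rfl⟩ := hu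
          simp
        rw [← FreeGroup.mul_mk, map_mul, map_mul]
        change (_ * A l).a = _ ∧ (_ * A l).c = _
        rw [Heisenberg.mul_a, Heisenberg.mul_c, h1, h2, hAa, hl]
        simp only [List.length_append, List.length_singleton, List.map_append, List.sum_append,
          List.map_singleton, List.sum_singleton, T, hl]
        constructor <;> ring
    rw [(hpre w List.prefix_rfl).2, ← List.sum_toFinset _ hnd,
      show w.toFinset = Finset.univ by ext l; simp [hmem l], Fintype.sum_prod_type]
    apply Finset.sum_eq_zero
    intro i _
    have h1 := hS' (i, true)
    have h2 := hAa (i, true)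
    rw [hAt] at h2
    simp only [letterInv, Bool.not_true] at h1
    simp only [Fintype.univ_bool, Finset.sum_singleton, Finset.mem_singleton, Bool.true_eq_false,
      not_false_eq_true, Finset.sum_insert, hAt, hAf, Heisenberg.inv_b, Heisenberg.inv_c,
      h2, ← h1]
    ring
  have hφ : φ = 1 := by
    ext ⟨i, b⟩
    cases b
    · have := key (Pi.single (i, true) 1)
      simpa [Pi.single_apply] using this
    · have := key (Pi.single (i, false) 1)
      simpa [Pi.single_apply] using this
  have hk : ∀ i, k i = 0 := by
    intro i
    have := hφx i
    rw [hφ] at this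
    exact (Multiplicative.ofAdd.injective this).symm
  have hjump : ∀ l, S (w.idxOf l + 1) = S (w.idxOf l) := by
    rintro ⟨i, b⟩
    have h1 := hk i
    simp only [k, sub_eq_zero] at h1
    cases b
    · have h2 := hS' (i, true)
      have h3 := hS' (i, false)
      simp only [letterInv, Bool.not_true, Bool.not_false] at h2 h3
      rw [h3, ← h2, h1]
    · exact h1
  intro p
  induction p with
  | zero => intro _; rfl
  | succ p ih =>
    intro hp
    have h := hjump w[p]
    rw [hnd.idxOf_getElem] at h
    rw [h, ih (by omega)]

/-- Under the same hypotheses, invariant sets of gaps are all or nothing. -/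
theorem GapInvariant.iff_zero_gap {g : ℕ} {x : Fin (2 * g) → SurfaceGroup g}
    (hx : Function.Bijective (FreeGroup.lift x)) {w : List (Fin (2 * g) × Bool)}
    (hnd : w.Nodup) (hmem : ∀ l, l ∈ w) (hw : FreeGroup.lift x (FreeGroup.mk w) = boundaryClass g)
    {S : ℕ → Prop} (hS : GapInvariant w S) {p : ℕ} (hp : p ≤ w.length) : S p ↔ S 0 := by
  classical
  have h : GapInvariant w (fun q => if S q then (1 : ℤ) else 0) := by
    intro q l hl
    simp only [hS q l hl]
  have := h.eq_zero_gap hx hnd hmem hw p hp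
  by_cases h1 : S p <;> by_cases h2 : S 0 <;> simp_all

/-- A word for the boundary class in a basis that contains each letter exactly once is reduced: the
gap inside a cancelling pair would be a class of its own. -/
theorem isReduced_of_lift_eq_boundaryClass {g : ℕ} {x : Fin (2 * g) → SurfaceGroup g}
    (hx : Function.Bijective (FreeGroup.lift x)) {w : List (Fin (2 * g) × Bool)}
    (hnd : w.Nodup) (hmem : ∀ l, l ∈ w) (hw : FreeGroup.lift x (FreeGroup.mk w) = boundaryClass g) :
    FreeGroup.IsReduced w := by
  unfold FreeGroup.IsReduced
  rw [List.isChain_iff_getElem]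
  intro p hp h1
  by_contra h2
  have hinv : w[p + 1] = letterInv w[p] := by
    ext
    · exact congrArg Fin.val h1.symm
    · simp only [letterInv]
      revert h2
      cases (w[p]).2 <;> cases (w[p + 1]).2 <;> simp
  have hS : GapInvariant w (fun q => q = p + 1) := by
    intro q l hl
    rw [List.getElem?_eq_some_iff] at hl
    obtain ⟨hq, rfl⟩ := hl
    simp only [Nat.add_right_cancel_iff, eq_iff_iff]
    constructor
    · rintro rfl
      rw [← hinv, hnd.idxOf_getElem]
    · intro h
      have h3 : letterInv w[q] = w[p + 1] := by
        rw [← Option.some_inj, ← List.getElem?_eq_getElem hp, ← h,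
          List.getElem?_idxOf_of_mem (hmem _)]
      rw [hinv] at h3
      have h4 := congrArg letterInv h3
      rw [letterInv_letterInv, letterInv_letterInv] at h4
      exact (hnd.getElem_inj_iff).1 h4
  have := (hS.iff_zero_gap hx hnd hmem hw hp.le).1 rfl
  omega

/-! ### The boundary order of a bordered fatgraph -/

namespace Fatgraph

variable (G : Fatgraph)

theorem boundaryNext_apply (e : G.OrEdge) : G.boundaryNext e = G.bar (G.nxt e) := rfl

theorem head_eq_iff {e f : G.OrEdge} : G.head e = G.head f ↔ G.nxt.SameCycle e f :=
  Quotient.eq (r := Equiv.Perm.SameCycle.setoid G.nxt)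

@[simp] theorem head_nxt (e : G.OrEdge) : G.head (G.nxt e) = G.head e :=
  G.head_eq_iff.2 (Equiv.Perm.sameCycle_apply_left.2 (Equiv.Perm.SameCycle.refl _ _))

/-- The oriented edges pointing to the same vertex as `e`, listed in their cyclic ordering. -/
theorem exists_list_star (e : G.OrEdge) (h : 2 ≤ G.valence (G.head e)) :
    ∃ B : List G.OrEdge,
      (List.range (G.valence (G.head e))).map (fun i => (G.nxt ^ i) e) = e :: B ∧
      (e :: B).Nodup ∧ (∀ x, x ∈ e :: B ↔ G.head x = G.head e) ∧
      (G.nxt ^ (G.valence (G.head e))) e = e := by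
  classical
  have := G.finite
  have := Fintype.ofFinite G.OrEdge
  have hsupp : e ∈ G.nxt.support := by
    rw [Equiv.Perm.mem_support]
    intro h1
    have : Subsingleton {x : G.OrEdge // G.head x = G.head e} := by
      refine ⟨fun x y => Subtype.ext ?_⟩
      have aux : ∀ z : G.OrEdge, G.head z = G.head e → z = e := fun z hz =>
        ((Equiv.Perm.SameCycle.eq_of_left (G.head_eq_iff.1 hz.symm) h1)).symm
      rw [aux _ x.2, aux _ y.2]
    have := Finite.card_le_one_iff_subsingleton.2 this
    unfold valence at h
    omega
  have hmem : ∀ x, x ∈ G.nxt.toList e ↔ G.head x = G.head e := fun x => by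
    rw [Equiv.Perm.mem_toList_iff, and_iff_left hsupp, ← G.head_eq_iff, eq_comm]
  have hlen : (G.nxt.toList e).length = G.valence (G.head e) := by
    rw [← List.toFinset_card_of_nodup (Equiv.Perm.nodup_toList _ _), valence,
      Nat.card_eq_fintype_card, Fintype.card_subtype]
    congr 1
    ext x
    simp [hmem]
  have hmap : (List.range (G.valence (G.head e))).map (fun i => (G.nxt ^ i) e) =
      G.nxt.toList e := by
    apply List.ext_getElem
    · simp [hlen]
    · intro i h1 h2
      rw [Equiv.Perm.getElem_toList]
      simp
  obtain ⟨b, B, hB⟩ := List.exists_cons_of_length_pos (l := G.nxt.toList e) (by omega)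
  have hbe : b = e := by
    have := Equiv.Perm.toList_getElem_zero G.nxt e hsupp
    simpa [hB] using this
  subst hbe
  refine ⟨B, hmap.trans hB, hB ▸ Equiv.Perm.nodup_toList _ _, hB ▸ hmem, ?_⟩
  rw [← hlen, Equiv.Perm.length_toList]
  simpa using (Equiv.Perm.pow_mod_card_support_cycleOf_self_apply G.nxt
    ((G.nxt.cycleOf b).support.card) b).symm

end Fatgraph

namespace BorderedFatgraph

variable (G : BorderedFatgraph)

theorem exists_pow_boundaryNext (e : G.OrEdge) : ∃ k : ℕ, (G.boundaryNext ^ k) G.tail = e := by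
  have := G.finite
  have hs : Subsingleton G.BoundaryCycle :=
    (Nat.card_eq_one_iff_unique.1 G.one_boundary).1
  have h : G.boundaryNext.SameCycle G.tail e :=
    Quotient.exact (s := Equiv.Perm.SameCycle.setoid G.boundaryNext)
      (hs.elim (Quotient.mk _ _) (Quotient.mk _ _))
  exact h.exists_nat_pow_eq

theorem pow_pos_apply (e : G.OrEdge) : (G.boundaryNext ^ G.pos e) G.tail = e :=
  Nat.sInf_mem (G.exists_pow_boundaryNext e)

theorem pos_le {e : G.OrEdge} {k : ℕ} (h : (G.boundaryNext ^ k) G.tail = e) : G.pos e ≤ k :=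
  Nat.sInf_le h

theorem pos_injective : Function.Injective G.pos := fun e f h => by
  rw [← G.pow_pos_apply e, h, G.pow_pos_apply]

@[simp] theorem pos_tail : G.pos G.tail = 0 :=
  Nat.le_zero.1 (G.pos_le (by simp))

/-- Positions increase by one along the boundary cycle until it returns to the tail. -/
theorem pos_boundaryNext {e : G.OrEdge} (h : G.boundaryNext e ≠ G.tail) :
    G.pos (G.boundaryNext e) = G.pos e + 1 := by
  apply le_antisymm
  · apply G.pos_le
    rw [pow_succ', Equiv.Perm.mul_apply, G.pow_pos_apply]
  · have h1 := G.pow_pos_apply (G.boundaryNext e)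
    obtain ⟨j, hj⟩ : ∃ j, G.pos (G.boundaryNext e) = j + 1 := by
      apply Nat.exists_eq_succ_of_ne_zero
      intro h0
      rw [h0] at h1
      exact h h1.symm
    rw [hj, pow_succ', Equiv.Perm.mul_apply] at h1
    rw [hj]
    exact Nat.succ_le_succ (G.pos_le (G.boundaryNext.injective h1))

/-- The univalent vertex. -/
def root : G.Vertex := G.head (G.bar G.tail)

theorem eq_bar_tail_of_head_eq_root {e : G.OrEdge} (h : G.head e = G.root) : e = G.bar G.tail := by
  have h1 := G.valence_tail
  have hs : Subsingleton {e : G.OrEdge // G.head e = G.head (G.bar G.tail)} :=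
    (Nat.card_eq_one_iff_unique.1 h1).1
  exact congrArg Subtype.val (hs.elim ⟨e, h⟩ ⟨G.bar G.tail, rfl⟩)

theorem three_le_valence {e : G.OrEdge} (h : G.head e ≠ G.root) : 3 ≤ G.valence (G.head e) :=
  G.valence_ge _ h

theorem bar_eq_iff {e f : G.OrEdge} : G.bar e = f ↔ e = G.bar f :=
  ⟨fun h => by rw [← h, G.bar_bar], fun h => by rw [h, G.bar_bar]⟩

theorem head_tail_ne_root : G.head G.tail ≠ G.root := fun h =>
  G.bar_ne G.tail (G.eq_bar_tail_of_head_eq_root h).symm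

/-- A boundary cycle that starts with the tail can only leave a vertex after having arrived there:
the predecessor of an oriented edge `f` other than the tail points to the origin of `f`. -/
theorem exists_pred {f : G.OrEdge} (hf : f ≠ G.tail) :
    ∃ u, G.head u = G.head (G.bar f) ∧ G.pos f = G.pos u + 1 := by
  refine ⟨G.boundaryNext.symm f, ?_, ?_⟩
  · have : G.nxt (G.boundaryNext.symm f) = G.bar f := by
        rw [← G.bar_bar (G.nxt _), ← G.boundaryNext_apply, Equiv.apply_symm_apply]
    rw [← this, G.head_nxt]
  · have h := G.pos_boundaryNext (e := G.boundaryNext.symm f)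
    rw [Equiv.apply_symm_apply] at h
    exact h hf

/-- The first oriented edge pointing to a vertex other than the root is automatically preferred, as
the boundary cycle cannot leave the vertex along its reversal before it has arrived there. -/
theorem inTree_iff {e : G.OrEdge} : G.InTree e ↔
    G.head e ≠ G.root ∧ ∀ x : G.OrEdge, G.head x = G.head e → G.pos e ≤ G.pos x := by
  constructor
  · rintro ⟨h1, h2⟩
    refine ⟨fun h => ?_, h2⟩
    rw [G.eq_bar_tail_of_head_eq_root h, Preferred, G.bar_bar, G.pos_tail] at h1
    omega
  · rintro ⟨h1, h2⟩
    refine ⟨?_, h2⟩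
    have hne : G.bar e ≠ G.tail := fun h => h1 (by rw [G.bar_eq_iff.1 h]; rfl)
    obtain ⟨u, hu1, hu2⟩ := G.exists_pred hne
    rw [G.bar_bar] at hu1
    have := h2 u hu1
    unfold Preferred
    omega

theorem inTree_tail : G.InTree G.tail :=
  G.inTree_iff.2 ⟨G.head_tail_ne_root, fun x _ => by simp⟩

theorem InTree.eq_of_head_eq {e f : G.OrEdge} (he : G.InTree e) (hf : G.InTree f)
    (h : G.head e = G.head f) : e = f :=
  G.pos_injective (le_antisymm (he.2 f h.symm) (hf.2 e h))

/-- Each vertex but the root is first reached by an edge of the greedy tree. -/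
theorem exists_inTree_head_eq {v : G.Vertex} (hv : v ≠ G.root) :
    ∃ f, G.InTree f ∧ G.head f = v := by
  have hne : Set.Nonempty {e : G.OrEdge | G.head e = v} := Quotient.exists_rep v
  have hf := Function.argminOn_mem G.pos _ hne
  refine ⟨Function.argminOn G.pos _ hne, G.inTree_iff.2 ⟨?_, ?_⟩, hf⟩
  · rw [show G.head _ = v from hf]
    exact hv
  · intro x hx
    exact Function.argminOn_le G.pos _ (hx.trans hf)

/-- An oriented edge starting at the end of a tree edge comes after that tree edge. -/
theorem InTree.pos_lt {e f : G.OrEdge} (he : G.InTree e) (h : G.head (G.bar f) = G.head e) :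
    G.pos e < G.pos f := by
  have hf : f ≠ G.tail := by
    rintro rfl
    exact (G.inTree_iff.1 he).1 h.symm
  obtain ⟨u, hu1, hu2⟩ := G.exists_pred hf
  have := he.2 u (hu1.trans h)
  omega

theorem preferred_or (e : G.OrEdge) : G.Preferred e ∨ G.Preferred (G.bar e) := by
  unfold Preferred
  rw [G.bar_bar]
  have : G.pos e ≠ G.pos (G.bar e) := fun h => G.bar_ne e (G.pos_injective h).symm
  omega

theorem Preferred.not_bar {e : G.OrEdge} (h : G.Preferred e) : ¬ G.Preferred (G.bar e) := by
  unfold Preferred at *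
  rw [G.bar_bar]
  omega

/-- An oriented edge outside the greedy tree. -/
def OffTree (e : G.OrEdge) : Prop := ¬ G.InTree e ∧ ¬ G.InTree (G.bar e)

theorem OffTree.bar {e : G.OrEdge} (h : G.OffTree e) : G.OffTree (G.bar e) :=
  ⟨h.2, by rw [G.bar_bar]; exact h.1⟩

theorem offTree_iff {e : G.OrEdge} :
    G.OffTree e ↔ e ∈ G.generators ∨ G.bar e ∈ G.generators := by
  constructor
  · intro h
    exact (G.preferred_or e).imp (fun h1 => ⟨h1, h.1⟩) (fun h1 => ⟨h1, h.2⟩)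
  · have aux : ∀ e, e ∈ G.generators → G.OffTree e := fun e h => ⟨h.2, fun h2 => h.1.not_bar _ h2.1⟩
    rintro (h | h)
    · exact aux e h
    · have := (aux _ h).bar
      rwa [G.bar_bar] at this

/-! ### Counting the generators -/

theorem card_edge : Nat.card G.Edge = Nat.card {e : G.OrEdge // G.Preferred e} := by
  symm
  have hbar : ∀ e f : G.OrEdge, G.bar.SameCycle e f → f = e ∨ f = G.bar e := by
    rintro e f ⟨k, rfl⟩
    have hsq : G.bar ^ (2 : ℤ) = 1 := by
      ext x
      rw [zpow_two, Equiv.Perm.mul_apply, G.bar_bar, Equiv.Perm.one_apply]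
    rcases Int.even_or_odd' k with ⟨j, rfl | rfl⟩
    · left; rw [zpow_mul, hsq, one_zpow, Equiv.Perm.one_apply]
    · right; rw [zpow_add, zpow_mul, hsq, one_zpow, one_mul, zpow_one]
  apply Nat.card_congr
  refine Equiv.ofBijective
    (fun e => Quotient.mk (Equiv.Perm.SameCycle.setoid G.bar) e.1) ⟨?_, ?_⟩
  · intro e f h
    rcases hbar _ _ (Quotient.exact h) with h1 | h1
    · exact Subtype.ext h1.symm
    · exact absurd (h1 ▸ f.2) (e.2.not_bar)
  · intro q
    obtain ⟨e, rfl⟩ := Quotient.exists_rep q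
    rcases G.preferred_or e with h | h
    · exact ⟨⟨e, h⟩, rfl⟩
    · refine ⟨⟨G.bar e, h⟩, Quotient.sound ?_⟩
      exact Equiv.Perm.sameCycle_apply_left.2 (Equiv.Perm.SameCycle.refl _ _)

theorem card_vertex : Nat.card G.Vertex = Nat.card {e : G.OrEdge // G.InTree e} + 1 := by
  have := G.finite
  rw [← Finite.card_option]
  symm
  apply Nat.card_congr
  refine Equiv.ofBijective (fun o => o.elim G.root fun e => G.head e.1) ⟨?_, ?_⟩
  · rintro (_ | e) (_ | f) h
    · rfl
    · exact absurd h.symm (G.inTree_iff.1 f.2).1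
    · exact absurd h (G.inTree_iff.1 e.2).1
    · exact congrArg some (Subtype.ext (e.2.eq_of_head_eq _ f.2 h))
  · intro v
    by_cases hv : v = G.root
    · exact ⟨none, hv.symm⟩
    · obtain ⟨f, hf1, hf2⟩ := G.exists_inTree_head_eq hv
      exact ⟨some ⟨f, hf1⟩, hf2⟩

/-- The greedy tree spans all vertices, so the Euler characteristic counts the edges outside it. -/
theorem card_generators {g : ℕ} (hg : G.HasGenus g) : Nat.card G.generators = 2 * g := by
  have := G.finite
  have h1 : Nat.card {e : G.OrEdge // G.Preferred e} =
      Nat.card {e : G.OrEdge // G.InTree e} + Nat.card G.generators := by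
    have hd : Disjoint {e : G.OrEdge | G.InTree e} G.generators := by
      rw [Set.disjoint_left]
      exact fun e h1 h2 => h2.2 h1
    have hu : {e : G.OrEdge | G.Preferred e} = {e : G.OrEdge | G.InTree e} ∪ G.generators := by
      ext e
      simp only [Set.mem_ofPred_eq, Set.mem_union, generators]
      constructor
      · intro h
        by_cases h2 : G.InTree e
        · exact Or.inl h2
        · exact Or.inr ⟨h, h2⟩
      · rintro (h | h)
        · exact h.1
        · exact h.1
    have := Set.ncard_union_eq hd (Set.toFinite _) (Set.toFinite _)
    rw [← hu] at this
    exact this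
  have h2 := hg
  unfold Fatgraph.HasGenus at h2
  rw [G.one_boundary, G.card_edge, G.card_vertex, h1] at h2
  push_cast at h2
  omega

end BorderedFatgraph

/-! ### Reading the boundary word around the greedy tree -/

/-- Replacing an entry of a chain by a chain with compatible ends. -/
theorem List.IsChain.splice {α : Type*} {R : α → α → Prop} {l l' B : List α} {y : α}
    (h : (l ++ y :: l').IsChain R) (hB : B.IsChain R) (hne : B ≠ [])
    (h1 : ∀ a b, R a y → b ∈ B.head? → R a b) (h2 : ∀ b c, b ∈ B.getLast? → R y c → R b c) :
    (l ++ (B ++ l')).IsChain R := by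
  rw [List.isChain_append] at h
  obtain ⟨ha, hb, hc⟩ := h
  rw [List.isChain_cons] at hb
  rw [List.isChain_append, List.isChain_append]
  refine ⟨ha, ⟨hB, hb.2, fun b hbB c hcl => h2 b c hbB (hb.1 c hcl)⟩, fun a hal b hbB => ?_⟩
  rw [List.head?_append_of_ne_nil _ hne] at hbB
  exact h1 a b (hc a hal y (by simp)) hbB

namespace BorderedFatgraph

variable (G : BorderedFatgraph)

/-- The relation between consecutive oriented edges `a`, `b` met on a walk around a subtree: both
point towards the subtree, and the boundary cycle, having arrived through `a`, leaves through
`bar b` later on. -/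
def Before (a b : G.OrEdge) : Prop := G.pos a < G.pos (G.bar b)

theorem before_nxt {a : G.OrEdge} (h : G.head a ≠ G.root) : G.Before a (G.nxt a) := by
  have h1 : G.boundaryNext a ≠ G.tail := by
    intro h2
    rw [G.boundaryNext_apply, G.bar_eq_iff] at h2
    apply h
    rw [← G.head_nxt, h2]
    rfl
  have := G.pos_boundaryNext h1
  rw [G.boundaryNext_apply] at this
  unfold Before
  omega

/-- The oriented edges other than the tree edge `e` at the end of `e`. -/
theorem InTree.exists_star {g : ℕ} (m : G.Marking g) {e : G.OrEdge} (he : G.InTree e) :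
    ∃ B : List G.OrEdge, B.Nodup ∧ (∀ x, x ∈ B ↔ G.head x = G.head e ∧ x ≠ e) ∧
      m.val e * (B.map m.val).prod = 1 ∧ (e :: B).IsChain G.Before ∧
      ∃ c ∈ B.getLast?, G.Before c e := by
  have hroot := (G.inTree_iff.1 he).1
  have hval := G.three_le_valence hroot
  obtain ⟨B, hmap, hnd, hmem, hpow⟩ := G.exists_list_star e (by omega)
  have hnd' := List.nodup_cons.1 hnd
  have hlen : (e :: B).length = G.valence (G.head e) := by rw [← hmap]; simp
  have hget : ∀ (i : ℕ) (hi : i < (e :: B).length), (e :: B)[i] = (G.nxt ^ i) e := by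
    intro i hi
    simp [← hmap]
  have hhead : ∀ (i : ℕ) (hi : i < (e :: B).length), G.head (e :: B)[i] ≠ G.root := by
    intro i hi
    rw [(hmem _).1 (List.getElem_mem hi)]
    exact hroot
  refine ⟨B, hnd'.2, fun x => ?_, ?_, ?_, ?_⟩
  · rw [← hmem x, List.mem_cons]
    constructor
    · intro h
      exact ⟨Or.inr h, fun h1 => hnd'.1 (h1 ▸ h)⟩
    · rintro ⟨h | h, h1⟩
      · exact absurd h h1
      · exact h
  · have := m.vertex e hroot
    rwa [show (fun i => m.val ((G.nxt ^ i) e)) = m.val ∘ fun i => (G.nxt ^ i) e from rfl,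
      ← List.map_map, hmap, List.map_cons, List.prod_cons] at this
  · rw [List.isChain_iff_getElem]
    intro i hi
    have h1 := G.before_nxt (hhead i (by omega))
    rw [hget i] at h1
    rw [hget i, hget (i + 1), pow_succ', Equiv.Perm.mul_apply]
    exact h1
  · have hB : 0 < B.length := by
      rw [List.length_cons] at hlen
      omega
    refine ⟨B[B.length - 1], by rw [List.getLast?_eq_getElem?]; simp [hB], ?_⟩
    have h0 : (e :: B)[B.length]'(by simp) = B[B.length - 1] := by
      rw [List.getElem_cons, dif_neg (by omega)]
    have h1 := G.before_nxt (hhead B.length (by simp))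
    rw [h0] at h1
    rwa [← h0, hget, ← Equiv.Perm.mul_apply, ← pow_succ', ← List.length_cons (a := e), hlen, hpow,
      ← hget B.length (by simp), h0] at h1

/-- `L` lists the oriented edges around the subtree consisting of the tree edges at the first `k`
positions: those which share their end with such a tree edge, while their reversal is no such tree
edge. They are listed in the order in which a walk around the subtree, starting after the tail,
meets them, and the product of their markings is the boundary class. -/
structure IsFrontier {g : ℕ} (m : G.Marking g) (k : ℕ) (L : List G.OrEdge) : Prop where
  nodup : L.Nodup
  mem_iff : ∀ x, x ∈ L ↔ (∃ f, G.InTree f ∧ G.pos f < k ∧ G.head f = G.head x ∧ x ≠ f) ∧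
    ¬ (G.InTree (G.bar x) ∧ G.pos (G.bar x) < k)
  prod_eq : (L.map m.val).prod = boundaryClass g
  chain : (G.tail :: L).IsChain G.Before

theorem Marking.val_bar {G : BorderedFatgraph} {g : ℕ} (m : G.Marking g) (e : G.OrEdge) :
    m.val (G.bar e) = (m.val e)⁻¹ :=
  (inv_eq_of_mul_eq_one_right (m.edge e)).symm

theorem exists_isFrontier_one {g : ℕ} (m : G.Marking g) : ∃ L, G.IsFrontier m 1 L := by
  obtain ⟨B, hnd, hmem, hprod, hchain, -⟩ := InTree.exists_star G m G.inTree_tail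
  refine ⟨B, hnd, fun x => ?_, ?_, hchain⟩
  · have hpos : ∀ f, G.pos f < 1 ↔ f = G.tail := fun f =>
      ⟨fun h => G.pos_injective (by rw [G.pos_tail]; omega), by rintro rfl; simp⟩
    simp only [hmem, hpos]
    constructor
    · rintro ⟨h1, h2⟩
      refine ⟨⟨G.tail, G.inTree_tail, rfl, h1.symm, h2⟩, ?_⟩
      rintro ⟨-, h3⟩
      rw [G.bar_eq_iff] at h3
      rw [h3] at h1
      exact G.head_tail_ne_root h1.symm
    · rintro ⟨⟨f, -, rfl, h1, h2⟩, -⟩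
      exact ⟨h1.symm, h2⟩
  · rw [← m.geometric, m.val_bar]
    exact eq_inv_of_mul_eq_one_right hprod

theorem IsFrontier.exists_succ {G : BorderedFatgraph} {g : ℕ} {m : G.Marking g} {k : ℕ}
    (hk : 1 ≤ k) {L : List G.OrEdge} (hL : G.IsFrontier m k L) :
    ∃ L', G.IsFrontier m (k + 1) L' := by
  by_cases hex : ∃ e, G.InTree e ∧ G.pos e = k
  swap
  · have hlt : ∀ f, G.InTree f → (G.pos f < k + 1 ↔ G.pos f < k) := by
      intro f hf
      have : G.pos f ≠ k := fun h => hex ⟨f, hf, h⟩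
      omega
    refine ⟨L, hL.nodup, fun x => ?_, hL.prod_eq, hL.chain⟩
    rw [hL.mem_iff]
    apply and_congr
    · exact exists_congr fun f => and_congr_right fun hf => by rw [hlt f hf]
    · exact not_congr (and_congr_right fun hf => by rw [hlt _ hf])
  obtain ⟨e, he, hek⟩ := hex
  have hlt : ∀ f, G.pos f < k + 1 ↔ G.pos f < k ∨ f = e := by
    intro f
    constructor
    · intro h
      rcases Nat.lt_succ_iff_lt_or_eq.1 h with h | h
      · exact Or.inl h
      · exact Or.inr (G.pos_injective (h.trans hek.symm))
    · rintro (h | rfl) <;> omega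
  have het : e ≠ G.tail := by
    rintro rfl
    rw [G.pos_tail] at hek
    omega
  have hbar : G.bar e ∈ L := by
    rw [hL.mem_iff]
    obtain ⟨u, hu1, hu2⟩ := G.exists_pred het
    have hr : G.head (G.bar e) ≠ G.root := fun h =>
      het (G.bar.injective (G.eq_bar_tail_of_head_eq_root h))
    obtain ⟨f, hf, hfh⟩ := G.exists_inTree_head_eq hr
    refine ⟨⟨f, hf, ?_, hfh, ?_⟩, ?_⟩
    · have := hf.2 u (hu1.trans hfh.symm)
      omega
    · rintro rfl
      exact he.1.not_bar _ hf.1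
    · rw [G.bar_bar]
      omega
  obtain ⟨l, l', rfl⟩ := List.append_of_mem hbar
  obtain ⟨B, hnd, hmem, hprod, hchain, c, hcB, hce⟩ := InTree.exists_star G m he
  have hBne : B ≠ [] := by rintro rfl; simp at hcB
  have hnd' : (G.bar e :: (l ++ l')).Nodup := List.nodup_middle.1 hL.nodup
  have hbe : ∀ x, x ∈ l ++ l' ↔ x ∈ l ++ G.bar e :: l' ∧ x ≠ G.bar e := by
    intro x
    rw [List.perm_middle.mem_iff, List.mem_cons]
    constructor
    · exact fun h => ⟨Or.inr h, fun h1 => (List.nodup_cons.1 hnd').1 (h1 ▸ h)⟩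
    · rintro ⟨h | h, h1⟩
      · exact absurd h h1
      · exact h
  have hperm : (l ++ (B ++ l')).Perm (B ++ (l ++ l')) := by
    rw [← List.append_assoc, ← List.append_assoc]
    exact List.perm_append_comm.append_right _
  refine ⟨l ++ (B ++ l'), ?_, fun x => ?_, ?_, ?_⟩
  · rw [hperm.nodup_iff, List.nodup_append']
    refine ⟨hnd, (List.nodup_cons.1 hnd').2, ?_⟩
    intro x hxB hx
    obtain ⟨⟨f, hf, hfk, hfx, -⟩, -⟩ := (hL.mem_iff x).1 ((hbe x).1 hx).1
    have := hf.eq_of_head_eq _ he (hfx.trans ((hmem x).1 hxB).1)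
    rw [this] at hfk
    omega
  · rw [hperm.mem_iff, List.mem_append, hmem, hbe, hL.mem_iff]
    simp only [hlt]
    constructor
    · rintro (⟨h1, h2⟩ | ⟨⟨⟨f, hf, hfk, hfx, hne⟩, h1⟩, h2⟩)
      · refine ⟨⟨e, he, Or.inr rfl, h1.symm, h2⟩, ?_⟩
        rintro ⟨-, h4⟩
        have := he.pos_lt G (f := G.bar x) (by rw [G.bar_bar]; exact h1)
        rcases h4 with h4 | h4
        · omega
        · rw [h4] at this
          omega
      · refine ⟨⟨f, hf, Or.inl hfk, hfx, hne⟩, ?_⟩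
        rintro ⟨h3, h4 | h4⟩
        · exact h1 ⟨h3, h4⟩
        · exact h2 (G.bar_eq_iff.1 h4)
    · rintro ⟨⟨f, hf, hfk | rfl, hfx, hne⟩, h1⟩
      · refine Or.inr ⟨⟨⟨f, hf, hfk, hfx, hne⟩, fun h2 => h1 ⟨h2.1, Or.inl h2.2⟩⟩, ?_⟩
        rintro rfl
        rw [G.bar_bar] at h1
        exact h1 ⟨he, Or.inr rfl⟩
      · exact Or.inl ⟨hfx.symm, hne⟩
  · rw [← hL.prod_eq]
    simp only [List.map_append, List.map_cons, List.prod_append, List.prod_cons]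
    rw [m.val_bar, eq_inv_of_mul_eq_one_right hprod]
  · have h1 : (G.tail :: l ++ (B ++ l')).IsChain G.Before := by
      apply List.IsChain.splice (y := G.bar e) (by simpa using hL.chain) hchain.of_cons hBne
      · intro a b hab hb
        refine Nat.lt_trans (m := G.pos e) ?_ ((List.isChain_cons.1 hchain).1 b hb)
        simpa [Before, G.bar_bar] using hab
      · intro b d hb hd
        rw [Option.mem_unique hb hcB]
        exact Nat.lt_trans hce hd
    simpa using h1

/-- The oriented edges outside the greedy tree, in the order in which a walk around the tree meets
them, spell the boundary class, and consecutive ones are in the relation `Before`. -/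
theorem exists_list_offTree {g : ℕ} (m : G.Marking g) :
    ∃ L : List G.OrEdge, L.Nodup ∧ (∀ x, x ∈ L ↔ G.OffTree x) ∧
      (L.map m.val).prod = boundaryClass g ∧ (G.tail :: L).IsChain G.Before := by
  have hfin := G.finite
  obtain ⟨N, hN⟩ := (Set.finite_range G.pos).bddAbove
  have hN : ∀ f, G.pos f < N + 1 := fun f => Nat.lt_succ_of_le (hN ⟨f, rfl⟩)
  have hex : ∀ k, ∃ L, G.IsFrontier m (k + 1) L := by
    intro k
    induction k with
    | zero => exact G.exists_isFrontier_one m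
    | succ k ih =>
      obtain ⟨L, hL⟩ := ih
      exact hL.exists_succ (by omega)
  obtain ⟨L, hL⟩ := hex N
  refine ⟨L, hL.nodup, fun x => ?_, hL.prod_eq, hL.chain⟩
  rw [hL.mem_iff]
  simp only [hN, true_and, and_true]
  refine and_congr_left fun hx => ?_
  constructor
  · rintro ⟨f, hf, hfx, hne⟩ hx1
    exact hne (hx1.eq_of_head_eq _ hf hfx.symm)
  · intro hx1
    have hr : G.head x ≠ G.root := by
      intro h
      rw [G.eq_bar_tail_of_head_eq_root h, G.bar_bar] at hx
      exact hx G.inTree_tail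
    obtain ⟨f, hf, hfx⟩ := G.exists_inTree_head_eq hr
    exact ⟨f, hf, hfx, fun h => hx1 (h ▸ hf)⟩

end BorderedFatgraph

/-! ### Preferred orientations are determined by the boundary word -/

/-- One step of the walk along the boundary cycle, seen on the gaps of a word `w`: from a gap, pass
along the edge of the letter behind it, and arrive at the gap behind the inverse letter. The last
gap has no letter behind it and is sent back to the first one. -/
def gapStep {α : Type*} [BEq α] (w : List (α × Bool)) (p : ℕ) : ℕ :=
  (w[p]?).elim 0 fun l => w.idxOf (letterInv l) + 1

/-- The gaps of `w`, in the order in which the boundary cycle visits them. -/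
def gapTrace {α : Type*} [BEq α] (w : List (α × Bool)) : List ℕ :=
  (List.range (w.length + 1)).map fun k => (gapStep w)^[k] 0

/-- Whether the boundary cycle runs through the inverse of the letter `i` before it runs through
`i`. -/
def inverseFirst {α : Type*} [BEq α] (w : List (α × Bool)) (i : α) : Bool :=
  decide ((gapTrace w).idxOf (w.idxOf (i, false) + 1) < (gapTrace w).idxOf (w.idxOf (i, true) + 1))

theorem List.idxOf_eq_of_forall_lt {α : Type*} [BEq α] [LawfulBEq α] {l : List α} {a : α} {k : ℕ}
    (h : l[k]? = some a) (hlt : ∀ j < k, l[j]? ≠ some a) : l.idxOf a = k := by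
  apply le_antisymm
  · by_contra! hk
    obtain ⟨hk1, hk2⟩ := List.getElem?_eq_some_iff.1 h
    have := List.not_of_lt_findIdx (p := (· == a)) (xs := l) hk
    simp [hk2] at this
  · by_contra! hk
    exact hlt _ hk (List.getElem?_idxOf_of_mem (List.mem_of_getElem? h))

namespace BorderedFatgraph

variable {G : BorderedFatgraph}

section Trace

variable {α : Type*} [BEq α] [LawfulBEq α] {L : List G.OrEdge} {lab : G.OrEdge → α × Bool}

/-- The walk over the gaps visits the gap behind each oriented edge `u` outside the greedy tree, and
before that only gaps behind oriented edges that precede `u` on the boundary cycle. -/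
theorem exists_iterate_gapStep [DecidableEq G.OrEdge] (hmem : ∀ x, x ∈ L ↔ G.OffTree x)
    (hnd : L.Nodup) (hchain : (G.tail :: L).IsChain G.Before)
    (hinj : ∀ x ∈ L, ∀ y ∈ L, lab x = lab y → x = y)
    (hbar : ∀ x ∈ L, lab (G.bar x) = letterInv (lab x)) :
    ∀ (n : ℕ), ∀ u ∈ G.tail :: L, G.pos u = n → ∃ k,
      (gapStep (L.map lab))^[k] 0 = (G.tail :: L).idxOf u ∧
      ∀ j < k, ∃ v ∈ G.tail :: L, (gapStep (L.map lab))^[j] 0 = (G.tail :: L).idxOf v ∧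
        G.pos v < G.pos u := by
  have htail : G.tail ∉ L := fun h => ((hmem _).1 h).1 G.inTree_tail
  have hnd' : (L.map lab).Nodup := (List.nodup_map_iff_inj_on hnd).2 hinj
  intro n
  induction n using Nat.strong_induction_on with
  | _ n ih =>
    rintro u hu rfl
    rcases List.mem_cons.1 hu with rfl | huL
    · exact ⟨0, by simp, fun j hj => absurd hj (by omega)⟩
    · have hbL : G.bar u ∈ L := (hmem _).2 ((hmem _).1 huL).bar
      obtain ⟨p, hp, hpu⟩ := List.getElem_of_mem hbL
      have hp' : p < (G.tail :: L).length := Nat.lt_succ_of_lt hp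
      have hv := List.isChain_iff_getElem.1 hchain p (by simpa using hp)
      rw [List.getElem_cons_succ, hpu, Before, G.bar_bar] at hv
      obtain ⟨k, hk1, hk2⟩ := ih _ hv ((G.tail :: L)[p]'hp') (List.getElem_mem _) rfl
      refine ⟨k + 1, ?_, ?_⟩
      · rw [Function.iterate_succ_apply', hk1,
          List.Nodup.idxOf_getElem (List.nodup_cons.2 ⟨htail, hnd⟩)]
        have h1 : (L.map lab)[p]? = some (lab (G.bar u)) := by
          rw [List.getElem?_map, List.getElem?_eq_getElem hp, hpu, Option.map_some]
        obtain ⟨q, hq, hqu⟩ := List.getElem_of_mem huL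
        have h2 : (L.map lab).idxOf (lab u) = q := by
          apply hnd'.idxOf_eq
          rw [List.getElem?_map, List.getElem?_eq_getElem hq, hqu, Option.map_some]
        have h3 : (G.tail :: L).idxOf u = q + 1 := by
          apply List.Nodup.idxOf_eq (List.nodup_cons.2 ⟨htail, hnd⟩)
          rw [List.getElem?_cons_succ, List.getElem?_eq_getElem hq, hqu]
        rw [gapStep, h1, Option.elim_some, hbar u huL, letterInv_letterInv, h2, h3]
      · intro j hj
        rcases Nat.lt_succ_iff_lt_or_eq.1 hj with hj | rfl
        · obtain ⟨v, hv1, hv2, hv3⟩ := hk2 j hj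
          exact ⟨v, hv1, hv2, hv3.trans hv⟩
        · exact ⟨_, List.getElem_mem _, hk1, hv⟩

/-- An orientation of an edge outside the greedy tree is preferred if and only if the walk over the
gaps of the boundary word visits the gap behind it before the gap behind its reversal. -/
theorem preferred_iff_idxOf_gapTrace_lt (hmem : ∀ x, x ∈ L ↔ G.OffTree x)
    (hnd : L.Nodup) (hchain : (G.tail :: L).IsChain G.Before)
    (hinj : ∀ x ∈ L, ∀ y ∈ L, lab x = lab y → x = y)
    (hbar : ∀ x ∈ L, lab (G.bar x) = letterInv (lab x)) {x : G.OrEdge} (hx : x ∈ L) :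
    G.Preferred x ↔
      (gapTrace (L.map lab)).idxOf ((L.map lab).idxOf (lab x) + 1) <
        (gapTrace (L.map lab)).idxOf ((L.map lab).idxOf (letterInv (lab x)) + 1) := by
  classical
  have hnd' : (L.map lab).Nodup := (List.nodup_map_iff_inj_on hnd).2 hinj
  have htail : G.tail ∉ L := fun h => ((hmem _).1 h).1 G.inTree_tail
  have hidx : ∀ u ∈ L, (G.tail :: L).idxOf u = (L.map lab).idxOf (lab u) + 1 := by
    intro u hu
    obtain ⟨q, hq, hqu⟩ := List.getElem_of_mem hu
    have h2 : (L.map lab).idxOf (lab u) = q := by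
      apply hnd'.idxOf_eq
      rw [List.getElem?_map, List.getElem?_eq_getElem hq, hqu, Option.map_some]
    rw [h2]
    apply List.Nodup.idxOf_eq (List.nodup_cons.2 ⟨htail, hnd⟩)
    rw [List.getElem?_cons_succ, List.getElem?_eq_getElem hq, hqu]
  have key : ∀ u ∈ L, ∃ k, (gapTrace (L.map lab)).idxOf ((L.map lab).idxOf (lab u) + 1) = k ∧
      (gapStep (L.map lab))^[k] 0 = (G.tail :: L).idxOf u ∧
      ∀ j < k, ∃ v ∈ G.tail :: L, (gapStep (L.map lab))^[j] 0 = (G.tail :: L).idxOf v ∧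
        G.pos v < G.pos u := by
    intro u hu
    obtain ⟨k, hk1, hk2⟩ := exists_iterate_gapStep hmem hnd hchain hinj hbar _ u
      (List.mem_cons_of_mem _ hu) rfl
    have hfirst : ∀ j < k, (gapStep (L.map lab))^[j] 0 ≠ (gapStep (L.map lab))^[k] 0 := by
      intro j hj h
      obtain ⟨v, hv1, hv2, hv3⟩ := hk2 j hj
      rw [hv2, hk1, List.idxOf_inj hv1] at h
      rw [h] at hv3
      omega
    -- The gaps visited up to the first visit are distinct, as the walk is deterministic.
    have hkn : k < (L.map lab).length + 1 := by
      have hcard := Finset.card_le_card_of_injOn (s := Finset.range (k + 1))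
        (t := Finset.range (L.length + 1)) (fun j => (gapStep (L.map lab))^[j] 0) ?_ ?_
      · simp only [Finset.card_range] at hcard
        rw [List.length_map]
        omega
      · intro j hj
        have hj := Finset.mem_range.1 hj
        have : ∃ v ∈ G.tail :: L, (gapStep (L.map lab))^[j] 0 = (G.tail :: L).idxOf v := by
          rcases Nat.lt_succ_iff_lt_or_eq.1 hj with hj | rfl
          · obtain ⟨v, hv1, hv2, -⟩ := hk2 j hj
            exact ⟨v, hv1, hv2⟩
          · exact ⟨u, List.mem_cons_of_mem _ hu, hk1⟩
        obtain ⟨v, hv1, hv2⟩ := this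
        have := List.idxOf_lt_length_of_mem hv1
        rw [List.length_cons] at this
        simp only [Finset.coe_range, Set.mem_Iio]
        rw [hv2]
        exact this
      · have aux : ∀ i j, i < j → j ≤ k →
            (gapStep (L.map lab))^[i] 0 ≠ (gapStep (L.map lab))^[j] 0 := by
          intro i j hij hjk h
          apply hfirst (k - j + i) (by omega)
          rw [Function.iterate_add_apply, h, ← Function.iterate_add_apply]
          congr 1
          omega
        intro i hi j hj h
        have hi := Finset.mem_range.1 hi
        have hj := Finset.mem_range.1 hj
        rcases lt_trichotomy i j with hij | hij | hij
        · exact absurd h (aux i j hij (by omega))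
        · exact hij
        · exact absurd h.symm (aux j i hij (by omega))
    have hget : ∀ j < (L.map lab).length + 1,
        (gapTrace (L.map lab))[j]? = some ((gapStep (L.map lab))^[j] 0) := by
      intro j hj
      rw [gapTrace, List.getElem?_map, List.getElem?_range hj, Option.map_some]
    refine ⟨k, ?_, hk1, hk2⟩
    rw [← hidx u hu]
    apply List.idxOf_eq_of_forall_lt
    · rw [hget k hkn, hk1]
    · intro j hj
      rw [hget j (by omega), ← hk1]
      exact fun h => hfirst j hj (Option.some_inj.1 h)
  have hbx : G.bar x ∈ L := (hmem _).2 ((hmem _).1 hx).bar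
  obtain ⟨k, hk, hk1, hk2⟩ := key x hx
  obtain ⟨k', hk', hk1', hk2'⟩ := key _ hbx
  rw [hbar x hx] at hk'
  rw [hk, hk']
  have haux : ∀ u ∈ L, ∀ v ∈ G.tail :: L, (G.tail :: L).idxOf u = (G.tail :: L).idxOf v → u = v :=
    fun u hu v _ h => (List.idxOf_inj (List.mem_cons_of_mem _ hu)).1 h
  constructor
  · intro hp
    by_contra! hle
    rcases hle.lt_or_eq with h | h
    · obtain ⟨v, hv1, hv2, hv3⟩ := hk2 k' h
      rw [← haux _ hbx v hv1 (hk1'.symm.trans hv2)] at hv3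
      exact lt_asymm hv3 hp
    · rw [h, hk1] at hk1'
      exact G.bar_ne x (haux x hx _ (List.mem_cons_of_mem _ hbx) hk1').symm
  · intro h
    obtain ⟨v, hv1, hv2, hv3⟩ := hk2' k h
    rwa [← haux _ hx v hv1 (hk1.symm.trans hv2)] at hv3

end Trace

end BorderedFatgraph

theorem FreeGroup.lift_mk_singleton_injective {α γ : Type*} [Group γ] {x : α → γ}
    (hx : Function.Injective (FreeGroup.lift x)) :
    Function.Injective fun l : α × Bool => FreeGroup.lift x (FreeGroup.mk [l]) := by
  classical
  intro l l' h
  have h1 := FreeGroup.reduce.sound (hx h)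
  rw [FreeGroup.reduce_singleton, FreeGroup.reduce_singleton] at h1
  simpa using h1

theorem FreeGroup.lift_mk_singleton_letterInv {α γ : Type*} [Group γ] (x : α → γ) (l : α × Bool) :
    FreeGroup.lift x (FreeGroup.mk [letterInv l]) = (FreeGroup.lift x (FreeGroup.mk [l]))⁻¹ := by
  obtain ⟨i, _ | _⟩ := l <;> simp [letterInv, FreeGroup.lift_mk]

theorem invertAt_apply {g : ℕ} (ε : Fin (2 * g) → Bool) (x : Fin (2 * g) → SurfaceGroup g)
    (i : Fin (2 * g)) : invertAt ε x i = FreeGroup.lift x (FreeGroup.mk [(i, !ε i)]) := by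
  cases h : ε i <;> simp [invertAt, h, FreeGroup.lift_mk]

/-- A letter with its index read as a natural number. -/
def natLetter {n : ℕ} (l : Fin n × Bool) : ℕ × Bool := (l.1.val, l.2)

theorem natLetter_injective {n : ℕ} : Function.Injective (natLetter (n := n)) := by
  rintro ⟨i, b⟩ ⟨j, c⟩ h
  simp only [natLetter, Prod.mk.injEq] at h
  exact Prod.ext (Fin.ext h.1) h.2

/-- If inverting some members of a basis gives the generators of a marked fatgraph, then the
boundary is a word in the basis that contains each letter once, and this word tells which members
are inverted. -/
theorem ArisesFromFatgraph.exists_word {g : ℕ} {x : Fin (2 * g) → SurfaceGroup g}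
    (hx : Function.Bijective (FreeGroup.lift x)) {ε : Fin (2 * g) → Bool}
    (h : ArisesFromFatgraph (Set.range (invertAt ε x))) :
    ∃ w : List (Fin (2 * g) × Bool), w.Nodup ∧ (∀ l, l ∈ w) ∧
      FreeGroup.lift x (FreeGroup.mk w) = boundaryClass g ∧
      ∀ i, ε i = inverseFirst (w.map natLetter) i.val := by
  obtain ⟨G, hG, m, hX⟩ := h
  have hfin := G.finite
  let V : Fin (2 * g) × Bool → SurfaceGroup g := fun l => FreeGroup.lift x (FreeGroup.mk [l])
  have hV : Function.Injective V := FreeGroup.lift_mk_singleton_injective hx.1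
  have he : ∀ i, ∃ e ∈ G.generators, m.val e = V (i, !ε i) := by
    intro i
    rw [← Set.mem_image, ← hX]
    exact ⟨i, invertAt_apply ε x i⟩
  choose e heg hem using he
  have heinj : Function.Injective fun i => (⟨e i, heg i⟩ : G.generators) := by
    intro i j h
    have h1 : V (i, !ε i) = V (j, !ε j) := by
      rw [← hem, ← hem, show e i = e j from congrArg Subtype.val h]
    exact congrArg Prod.fst (hV h1)
  have hesurj : ∀ y ∈ G.generators, ∃ i, e i = y := by
    have hb := (Nat.bijective_iff_injective_and_card _).2
      ⟨heinj, by rw [G.card_generators hG, Nat.card_fin]⟩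
    intro y hy
    obtain ⟨i, hi⟩ := hb.2 ⟨y, hy⟩
    exact ⟨i, congrArg Subtype.val hi⟩
  let H : Fin (2 * g) × Bool → G.OrEdge := fun l =>
    if l.2 = ε l.1 then G.bar (e l.1) else e l.1
  have hHe : ∀ i, H (i, !ε i) = e i := fun i => by simp [H]
  have hHb : ∀ i, H (i, ε i) = G.bar (e i) := fun i => by simp [H]
  have hcases : ∀ l : Fin (2 * g) × Bool, l = (l.1, ε l.1) ∨ l = (l.1, !ε l.1) := by
    rintro ⟨i, b⟩
    cases b <;> cases ε i <;> simp
  have hHm : ∀ l, m.val (H l) = V l := by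
    intro l
    rcases hcases l with h | h <;> rw [h]
    · have := FreeGroup.lift_mk_singleton_letterInv x (l.1, !ε l.1)
      simp only [letterInv, Bool.not_not] at this
      rw [hHb, m.val_bar, hem]
      exact this.symm
    · rw [hHe, hem]
  have hHbar : ∀ l, G.bar (H l) = H (letterInv l) := by
    intro l
    rcases hcases l with h | h <;> rw [h]
    · rw [hHb, G.bar_bar, ← hHe]
      rfl
    · rw [hHe, ← hHb]
      simp [letterInv]
  have hHinj : Function.Injective H := fun l l' h => hV (by rw [← hHm, ← hHm, h])
  have hHoff : ∀ y, G.OffTree y ↔ ∃ l, H l = y := by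
    intro y
    rw [G.offTree_iff]
    constructor
    · rintro (h | h)
      · obtain ⟨i, rfl⟩ := hesurj y h
        exact ⟨_, hHe i⟩
      · obtain ⟨i, hi⟩ := hesurj _ h
        exact ⟨_, by rw [hHb i, hi, G.bar_bar]⟩
    · rintro ⟨l, rfl⟩
      rcases hcases l with h | h <;> rw [h]
      · right
        rw [hHb, G.bar_bar]
        exact heg _
      · left
        rw [hHe]
        exact heg _
  obtain ⟨L, hnd, hmem, hprod, hchain⟩ := G.exists_list_offTree m
  obtain ⟨w, rfl⟩ : ∃ w : List (Fin (2 * g) × Bool), w.map H = L := by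
    have : L ∈ Set.range (List.map H) := by
      rw [Set.range_list_map]
      exact fun y hy => (hHoff y).1 ((hmem y).1 hy)
    exact this
  let lab : G.OrEdge → ℕ × Bool := Function.extend H natLetter fun _ => (0, false)
  have hlab : ∀ l, lab (H l) = natLetter l := fun l => hHinj.extend_apply _ _ l
  have hwmem : ∀ l, l ∈ w := fun l => by
    have := (hmem (H l)).2 ((hHoff _).2 ⟨l, rfl⟩)
    rwa [List.mem_map_of_injective hHinj] at this
  refine ⟨w, hnd.of_map, hwmem, ?_, fun i => ?_⟩
  · rw [← hprod, List.map_map, FreeGroup.lift_mk]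
    congr 1
    apply List.map_congr_left
    rintro ⟨i, _ | _⟩ - <;> simp [hHm, V, FreeGroup.lift_mk]
  · have hmap : w.map natLetter = (w.map H).map lab := by
      rw [List.map_map]
      exact List.map_congr_left fun l _ => (hlab l).symm
    have hpref := BorderedFatgraph.preferred_iff_idxOf_gapTrace_lt (lab := lab) hmem hnd hchain
      (by
        intro y hy z hz hyz
        obtain ⟨l, rfl⟩ := (hHoff y).1 ((hmem y).1 hy)
        obtain ⟨l', rfl⟩ := (hHoff z).1 ((hmem z).1 hz)
        rw [hlab, hlab] at hyz
        rw [natLetter_injective hyz])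
      (by
        intro y hy
        obtain ⟨l, rfl⟩ := (hHoff y).1 ((hmem y).1 hy)
        rw [hHbar, hlab, hlab]
        rfl)
      ((hmem (H (i, false))).2 ((hHoff _).2 ⟨_, rfl⟩))
    rw [← hmap, hlab] at hpref
    rw [Bool.eq_iff_iff, inverseFirst, decide_eq_true_eq]
    refine Iff.trans ?_ hpref
    cases hε : ε i
    · have := hHb i
      rw [hε] at this
      rw [this]
      simpa using (heg i).1.not_bar
    · have := hHe i
      rw [hε] at this
      simp only [Bool.not_true] at this
      rw [this]
      simpa using (heg i).1

/-! ### The fatgraph with one interior vertex -/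

namespace OneVertex

variable {n : ℕ} {ν : Fin n → Fin n}

/-- Reversal of orientation for the fatgraph with one interior vertex. The oriented edges pointing
to the interior vertex are the tail `some 0` and the ends `some (p + 1)` of the loops, matched by
the involution `ν`; the reversal of the tail is `none`. -/
def barFun (ν : Fin n → Fin n) : Option (Fin (n + 1)) → Option (Fin (n + 1))
  | none => some 0
  | some j => Fin.cases none (fun p => some (ν p).succ) j

@[simp] theorem barFun_none : barFun ν none = some 0 := rfl
@[simp] theorem barFun_zero : barFun ν (some 0) = none := rfl
@[simp] theorem barFun_succ (p : Fin n) : barFun ν (some p.succ) = some (ν p).succ := rfl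

theorem barFun_involutive (hν : Function.Involutive ν) : Function.Involutive (barFun ν) := by
  rintro (_ | j)
  · rfl
  · induction j using Fin.cases with
    | zero => rfl
    | succ p => simp [hν p]

/-- The cyclic ordering `0, 1, …, n` around the interior vertex. -/
def nxt (n : ℕ) : Equiv.Perm (Option (Fin (n + 1))) := (finRotate (n + 1)).optionCongr

theorem nxt_some_of_lt {k : ℕ} (h : k < n) :
    nxt n (some ⟨k, by omega⟩) = some ⟨k + 1, by omega⟩ := by
  simp [nxt, finRotate_of_lt h]

theorem nxt_some_last : nxt n (some (Fin.last n)) = some 0 := by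
  simp [nxt]

theorem nxt_pow_zero : ∀ (k : ℕ) (h : k < n + 1), (nxt n ^ k) (some 0) = some ⟨k, h⟩
  | 0, _ => rfl
  | k + 1, h => by
    rw [pow_succ', Equiv.Perm.mul_apply, nxt_pow_zero k (by omega), nxt_some_of_lt (by omega)]

theorem nxt_pow_card : (nxt n ^ (n + 1)) (some 0) = some 0 := by
  rw [pow_succ', Equiv.Perm.mul_apply, nxt_pow_zero n (by omega)]
  exact nxt_some_last

/-- The fatgraph with one interior vertex, given by the matching `ν` of the ends of its loops. -/
abbrev graph (hν : Function.Involutive ν) (hne : ∀ p, ν p ≠ p) : Fatgraph where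
  OrEdge := Option (Fin (n + 1))
  finite := inferInstance
  bar := (barFun_involutive hν).toPerm
  bar_bar := barFun_involutive hν
  bar_ne := by
    rintro (_ | j)
    · simp
    · induction j using Fin.cases with
      | zero => simp
      | succ p => simp [hne p]
  nxt := nxt n
  connected := by
    have key : ∀ e : Option (Fin (n + 1)), ∃ p : Equiv.Perm (Option (Fin (n + 1))),
        p ∈ Subgroup.closure {(barFun_involutive hν).toPerm, nxt n} ∧ p (some 0) = e := by
      rintro (_ | ⟨k, hk⟩)
      · exact ⟨_, Subgroup.subset_closure (Or.inl rfl), rfl⟩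
      · exact ⟨nxt n ^ k, pow_mem (Subgroup.subset_closure
          (Set.mem_insert_of_mem _ (Set.mem_singleton _))) k, nxt_pow_zero k hk⟩
    intro e f
    obtain ⟨p, hp, rfl⟩ := key e
    obtain ⟨q, hq, rfl⟩ := key f
    exact ⟨q * p⁻¹, mul_mem hq (inv_mem hp), by simp⟩

variable (hν : Function.Involutive ν) (hne : ∀ p, ν p ≠ p)

theorem head_some (j : Fin (n + 1)) :
    (graph hν hne).head (some j) = (graph hν hne).head (some 0) := by
  symm
  rw [Fatgraph.head_eq_iff]
  exact ⟨j.val, by rw [zpow_natCast]; exact nxt_pow_zero j.val j.isLt⟩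

theorem head_eq_head_none {e : Option (Fin (n + 1))}
    (h : (graph hν hne).head e = (graph hν hne).head none) : e = none :=
  (Equiv.Perm.SameCycle.eq_of_right (((graph hν hne).head_eq_iff).1 h) rfl)

theorem valence_none : (graph hν hne).valence ((graph hν hne).head none) = 1 := by
  unfold Fatgraph.valence
  rw [Nat.card_eq_one_iff_unique]
  exact ⟨⟨fun x y => Subtype.ext
    ((head_eq_head_none hν hne x.2).trans (head_eq_head_none hν hne y.2).symm)⟩, ⟨⟨none, rfl⟩⟩⟩

theorem valence_some (j : Fin (n + 1)) :
    (graph hν hne).valence ((graph hν hne).head (some j)) = n + 1 := by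
  unfold Fatgraph.valence
  refine (Nat.card_congr (Equiv.ofBijective (fun i : Fin (n + 1) =>
    ⟨some i, (head_some hν hne i).trans (head_some hν hne j).symm⟩)
    ⟨?_, ?_⟩)).symm.trans (Nat.card_fin (n + 1))
  · intro i k h
    exact Option.some_inj.1 (congrArg Subtype.val h)
  · rintro ⟨_ | i, hi⟩
    · exact absurd (head_eq_head_none hν hne hi.symm) (by simp)
    · exact ⟨i, rfl⟩

theorem boundaryNext_some (p : Fin n) :
    (graph hν hne).boundaryNext (some (ν p).castSucc) = some p.succ := by
  rw [Fatgraph.boundaryNext_apply]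
  change barFun ν (nxt n (some (ν p).castSucc)) = _
  have := nxt_some_of_lt (ν p).isLt
  rw [show (ν p).castSucc = ⟨(ν p).val, by omega⟩ from rfl, this]
  change barFun ν (some (ν p).succ) = _
  rw [barFun_succ, hν p]

/-- There is only one boundary cycle if the only sets of gaps `S ⊆ {0, …, n}` compatible with the
matching are the trivial ones. -/
theorem sameCycle_boundaryNext
    (hS : ∀ S : ℕ → Prop, (∀ p : Fin n, S (p.val + 1) ↔ S (ν p).val) → ∀ p ≤ n, S p ↔ S 0)
    (e : Option (Fin (n + 1))) : (graph hν hne).boundaryNext.SameCycle e (some 0) := by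
  rcases e with _ | ⟨k, hk⟩
  · exact ⟨1, rfl⟩
  · have := hS
      (fun q => ∃ h : q < n + 1, (graph hν hne).boundaryNext.SameCycle (some ⟨q, h⟩) (some 0)) ?_ k
      (by omega)
    · obtain ⟨_, h⟩ := this.2 ⟨by omega, Equiv.Perm.SameCycle.refl _ _⟩
      exact h
    · intro p
      have hp : p.val + 1 < n + 1 := by omega
      have hp' : (ν p).val < n + 1 := by omega
      simp only [hp, hp', exists_true_left]
      change (graph hν hne).boundaryNext.SameCycle (some p.succ) (some 0) ↔
        (graph hν hne).boundaryNext.SameCycle (some (ν p).castSucc) (some 0)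
      rw [← boundaryNext_some hν hne p, Equiv.Perm.sameCycle_apply_left]

/-- The bordered fatgraph with one interior vertex. -/
abbrev bordered
    (hS : ∀ S : ℕ → Prop, (∀ p : Fin n, S (p.val + 1) ↔ S (ν p).val) → ∀ p ≤ n, S p ↔ S 0)
    (hn : 2 ≤ n) : BorderedFatgraph where
  toFatgraph := graph hν hne
  one_boundary := by
    rw [Nat.card_eq_one_iff_unique]
    refine ⟨⟨fun x y => ?_⟩, ⟨Quotient.mk _ none⟩⟩
    obtain ⟨e, rfl⟩ := Quotient.exists_rep x
    obtain ⟨f, rfl⟩ := Quotient.exists_rep y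
    exact Quotient.sound ((sameCycle_boundaryNext hν hne hS e).trans
      (sameCycle_boundaryNext hν hne hS f).symm)
  tail := some 0
  valence_tail := valence_none hν hne
  valence_ge := by
    intro v hv
    obtain ⟨_ | j, rfl⟩ := Quotient.exists_rep v
    · exact absurd rfl hv
    · have := valence_some hν hne j
      change 3 ≤ (graph hν hne).valence ((graph hν hne).head (some j))
      omega

end OneVertex

namespace BorderedFatgraph

variable (G : BorderedFatgraph)

theorem card_orEdge : Nat.card G.OrEdge = 2 * Nat.card G.Edge := by
  have := G.finite
  have hbool : Nat.card Bool = 2 := by simp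
  rw [G.card_edge, mul_comm, ← hbool, ← Nat.card_prod]
  symm
  apply Nat.card_congr
  refine Equiv.ofBijective (fun y : {e // G.Preferred e} × Bool => if y.2 then G.bar y.1 else y.1)
    ⟨?_, ?_⟩
  · rintro ⟨⟨e, he⟩, _ | _⟩ ⟨⟨f, hf⟩, _ | _⟩ h
    · simpa using h
    · simp only [Bool.false_eq_true, if_false, if_true] at h
      exact absurd (h ▸ he) hf.not_bar
    · simp only [Bool.false_eq_true, if_false, if_true] at h
      exact absurd (h ▸ hf) he.not_bar
    · simpa using h
  · intro e
    rcases G.preferred_or e with h | h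
    · exact ⟨⟨⟨e, h⟩, false⟩, by simp⟩
    · exact ⟨⟨⟨_, h⟩, true⟩, by simp [G.bar_bar]⟩

end BorderedFatgraph

/-- Cyclic rotation does not affect whether a product is trivial. -/
theorem prod_range_pow_apply_eq_one {α M : Type*} [Group M] (σ : Equiv.Perm α) (f : α → M) (N : ℕ)
    {e : α} (hN : (σ ^ N) e = e) (h : ((List.range N).map fun i => f ((σ ^ i) e)).prod = 1)
    (k : ℕ) : ((List.range N).map fun i => f ((σ ^ i) ((σ ^ k) e))).prod = 1 := by
  induction k with
  | zero => simpa using h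
  | succ k ih =>
    have h1 : (List.range (N + 1)).map (fun i => f ((σ ^ i) ((σ ^ k) e))) =
        f ((σ ^ k) e) :: (List.range N).map fun i => f ((σ ^ i) ((σ ^ (k + 1)) e)) := by
      rw [List.range_succ_eq_map, List.map_cons, List.map_map]
      congr 1
      apply List.map_congr_left
      intro i _
      simp only [Function.comp_apply, ← Equiv.Perm.mul_apply, ← pow_add]
      congr 3
      omega
    rw [List.range_succ, List.map_append] at h1
    have h2 := congrArg List.prod h1
    have h3 : (σ ^ N) ((σ ^ k) e) = (σ ^ k) e := by
      rw [← Equiv.Perm.mul_apply, (Commute.refl σ).pow_pow N k, Equiv.Perm.mul_apply, hN]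
    rw [List.prod_append, ih, one_mul, List.prod_cons, List.map_singleton, List.prod_singleton,
      h3] at h2
    exact mul_eq_left.1 h2.symm

/-- If the boundary class is written in a basis as a word containing each letter once, then the
loops of the one-vertex fatgraph built from this word realize the basis up to inversions. -/
theorem exists_arisesFromFatgraph {g : ℕ} (hg : 1 ≤ g) {x : Fin (2 * g) → SurfaceGroup g}
    (hx : Function.Bijective (FreeGroup.lift x)) (hgen : Subgroup.closure (Set.range x) = ⊤)
    {w : List (Fin (2 * g) × Bool)} (hnd : w.Nodup) (hmem : ∀ l, l ∈ w)
    (hw : FreeGroup.lift x (FreeGroup.mk w) = boundaryClass g) :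
    ∃ ε : Fin (2 * g) → Bool, ArisesFromFatgraph (Set.range (invertAt ε x)) := by
  classical
  have hlen : w.length = 4 * g := length_eq_of_nodup hnd hmem
  let pl : Fin (2 * g) × Bool → Fin w.length :=
    fun l => ⟨w.idxOf l, List.idxOf_lt_length_of_mem (hmem l)⟩
  have hwpl : ∀ l, w[pl l] = l := fun l => List.getElem_idxOf _
  have hplw : ∀ p : Fin w.length, pl w[p] = p := fun p =>
    Fin.ext (by simp only [pl]; exact hnd.idxOf_getElem p.1 p.2)
  let ν : Fin w.length → Fin w.length := fun p => pl (letterInv w[p])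
  have hνpl : ∀ l, ν (pl l) = pl (letterInv l) := fun l => by simp only [ν, hwpl]
  have hν : Function.Involutive ν := by
    intro p
    simp only [ν, hwpl, letterInv_letterInv, hplw]
  have hne : ∀ p, ν p ≠ p := by
    intro p h
    have := congrArg (fun q : Fin w.length => w[q]) h
    simp only [ν, hwpl] at this
    exact letterInv_ne _ this
  have hS : ∀ S : ℕ → Prop, (∀ p : Fin w.length, S (p.val + 1) ↔ S (ν p).val) →
      ∀ p ≤ w.length, S p ↔ S 0 := by
    intro S h p hp
    refine GapInvariant.iff_zero_gap hx hnd hmem hw (S := S) ?_ hp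
    intro q l hl
    obtain ⟨hq, rfl⟩ := List.getElem?_eq_some_iff.1 hl
    exact propext (h ⟨q, hq⟩)
  let G := OneVertex.bordered hν hne hS (by omega)
  let V : Fin (2 * g) × Bool → SurfaceGroup g := fun l => FreeGroup.lift x (FreeGroup.mk [l])
  have hVinv : ∀ l, V (letterInv l) = (V l)⁻¹ := FreeGroup.lift_mk_singleton_letterInv x
  have hVw : (w.map V).prod = boundaryClass g := by
    rw [← hw, FreeGroup.lift_mk]
    congr 1
    apply List.map_congr_left
    rintro ⟨i, _ | _⟩ - <;> simp [V, FreeGroup.lift_mk]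
  let val : Option (Fin (w.length + 1)) → SurfaceGroup g := fun o =>
    o.elim (boundaryClass g) (Fin.cases (boundaryClass g)⁻¹ fun p => V w[p])
  have hval : ∀ p : Fin w.length, val (some p.succ) = V w[p] := fun p => rfl
  have hval0 : val (some 0) = (boundaryClass g)⁻¹ := rfl
  have hedge : ∀ e : Option (Fin (w.length + 1)), val e * val (OneVertex.barFun ν e) = 1 := by
    rintro (_ | j)
    · simp [val]
    · induction j using Fin.cases with
      | zero => simp [val]
      | succ p =>
        rw [OneVertex.barFun_succ, hval, hval]
        simp only [ν, hwpl, hVinv, mul_inv_cancel]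
  have hprod0 : ((List.range (w.length + 1)).map
      fun i => val ((OneVertex.nxt w.length ^ i) (some 0))).prod = 1 := by
    have : (List.range (w.length + 1)).map
        (fun i => val ((OneVertex.nxt w.length ^ i) (some 0))) =
        (boundaryClass g)⁻¹ :: w.map V := by
      apply List.ext_getElem
      · simp
      · intro i h1 h2
        simp only [List.length_map, List.length_range] at h1
        rw [List.getElem_map, List.getElem_range, OneVertex.nxt_pow_zero i h1]
        cases i with
        | zero => rfl
        | succ i =>
          rw [List.getElem_cons_succ, List.getElem_map]
          rfl
    rw [this, List.prod_cons, hVw, inv_mul_cancel]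
  let m : G.Marking g :=
    { val := val
      edge := hedge
      vertex := by
        rintro (_ | ⟨k, hk⟩) he
        · exact absurd rfl he
        · have h1 : G.valence (G.head (some ⟨k, hk⟩)) = w.length + 1 :=
            OneVertex.valence_some hν hne _
          rw [h1, ← OneVertex.nxt_pow_zero k hk]
          exact prod_range_pow_apply_eq_one _ val _ OneVertex.nxt_pow_card hprod0 k
      surjective := by
        rw [eq_top_iff, ← hgen, Subgroup.closure_le]
        rintro _ ⟨i, rfl⟩
        apply Subgroup.subset_closure
        refine ⟨some (pl (i, true)).succ, ?_⟩
        rw [hval, hwpl]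
        simp [V, FreeGroup.lift_mk]
      geometric := rfl }
  have hinTree : ∀ e, G.InTree e ↔ e = G.tail := by
    intro e
    constructor
    · intro h
      apply h.eq_of_head_eq _ G.inTree_tail
      rcases e with _ | j
      · exact absurd rfl (G.inTree_iff.1 h).1
      · exact OneVertex.head_some hν hne j
    · rintro rfl
      exact G.inTree_tail
  have hgenus : G.HasGenus g := by
    have h1 := G.card_orEdge
    rw [show Nat.card G.OrEdge = w.length + 2 from by
      change Nat.card (Option (Fin (w.length + 1))) = _
      rw [Finite.card_option, Nat.card_fin]] at h1
    have h2 : Nat.card {e : G.OrEdge // G.InTree e} = 1 := by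
      simp only [hinTree]
      exact Nat.card_unique
    have h3 := G.card_vertex
    unfold Fatgraph.HasGenus
    rw [G.one_boundary, h3, h2]
    push_cast
    omega
  have hbarpl : ∀ l, G.bar (some (pl l).succ) = some (pl (letterInv l)).succ := by
    intro l
    rw [← hνpl]
    rfl
  have hplgen : ∀ l, some (pl l).succ ∈ G.generators ↔ G.Preferred (some (pl l).succ) := by
    intro l
    refine ⟨fun h => h.1, fun h => ⟨h, fun h1 => ?_⟩⟩
    exact Fin.succ_ne_zero _ (Option.some_inj.1 ((hinTree _).1 h1))
  have hvalpl : ∀ l, val (some (pl l).succ) = V l := fun l => by rw [hval, hwpl]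
  let ε : Fin (2 * g) → Bool := fun i => decide (¬ G.Preferred (some (pl (i, true)).succ))
  have hε : ∀ i b, G.Preferred (some (pl (i, b)).succ) ↔ b = !ε i := by
    intro i b
    cases b
    · have h1 := hbarpl (i, true)
      simp only [letterInv, Bool.not_true] at h1
      rw [← h1]
      have h2 : G.Preferred (G.bar (some (pl (i, true)).succ)) ↔
          ¬ G.Preferred (some (pl (i, true)).succ) :=
        ⟨fun h h' => h'.not_bar _ h, fun h => (G.preferred_or _).resolve_left h⟩
      rw [h2]
      simp [ε]
    · simp [ε]
  refine ⟨ε, G, hgenus, m, ?_⟩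
  ext γ
  constructor
  · rintro ⟨i, rfl⟩
    rw [invertAt_apply]
    exact ⟨some (pl (i, !ε i)).succ, (hplgen _).2 ((hε _ _).2 rfl), hvalpl _⟩
  · rintro ⟨e, he, rfl⟩
    have heT : e ≠ G.tail := fun h => he.2 ((hinTree e).2 h)
    have heB : e ≠ G.bar G.tail := by
      rintro rfl
      exact G.inTree_tail.1.not_bar _ he.1
    rcases e with _ | j
    · exact absurd rfl heB
    · induction j using Fin.cases with
      | zero => exact absurd rfl heT
      | succ p =>
        rw [← hplw p] at he ⊢
        generalize hl : w[p] = l at he ⊢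
        obtain ⟨i, b⟩ := l
        refine ⟨i, ?_⟩
        rw [invertAt_apply, ← (hε i b).1 he.1]
        exact (hvalpl _).symm

/-! ### Computing the inversions -/

/-- The word `a₁ b₁ a₁⁻¹ b₁⁻¹ ⋯` of length `4 * g` for the boundary class. -/
def boundaryWord (g : ℕ) : List ((ℕ × Bool) × Bool) :=
  (List.range g).flatMap fun i =>
    [((i, false), true), ((i, true), true), ((i, false), false), ((i, true), false)]

/-- The words of length `k` in the letters with index less than `n`. -/
def wordsOfLength (n k : ℕ) : List (List (ℕ × Bool)) :=
  Nat.rec [[]] (fun _ W => W.flatMap fun w =>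
    ((List.range n).flatMap fun i => [(i, true), (i, false)]).map fun l => l :: w) k

/-- Replace the letters of `w` by the words in the list `us` and their inverses. -/
def substWord (us : List (List ((ℕ × Bool) × Bool))) (w : List (ℕ × Bool)) :
    List ((ℕ × Bool) × Bool) :=
  w.flatMap fun l =>
    cond l.2 (us.getD l.1 []) ((us.getD l.1 []).map fun s => (s.1, !s.2)).reverse

/-- Whether `w` turns into the boundary class when the words `us` are substituted. -/
def spellsBoundary (a : ℕ × List (List ((ℕ × Bool) × Bool))) (w : List (ℕ × Bool)) : Bool :=
  decide (FreeGroup.reduce (substWord a.2 w) = FreeGroup.reduce (boundaryWord a.1))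

/-- A word of length `4 * g` that spells the boundary class, found by exhaustive search. -/
def findWord (a : ℕ × List (List ((ℕ × Bool) × Bool))) : List (ℕ × Bool) :=
  (wordsOfLength (2 * a.1) (4 * a.1)).getD
    ((wordsOfLength (2 * a.1) (4 * a.1)).findIdx (spellsBoundary a)) []

/-- The algorithm that finds out which elements of a tuple have to be inverted. -/
def findInversions (a : ℕ × List (List ((ℕ × Bool) × Bool))) : List Bool :=
  (List.range (2 * a.1)).map (inverseFirst (findWord a))

section Primrec

open Primrec

theorem Primrec.freeGroup_reduce {α : Type*} [Primcodable α] [DecidableEq α] :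
    Primrec (FreeGroup.reduce (α := α)) := by
  have hcond : PrimrecPred fun q : (List (α × Bool) × (α × Bool) × List (α × Bool)) ×
      ((α × Bool) × List (α × Bool)) =>
      q.1.2.1.1 = q.2.1.1 ∧ q.1.2.1.2 = !q.2.1.2 :=
    (Primrec.eq.comp (fst.comp (fst.comp (snd.comp fst))) (fst.comp (fst.comp snd))).and
      (Primrec.eq.comp (snd.comp (fst.comp (snd.comp fst)))
        (Primrec.not.comp (snd.comp (fst.comp snd))))
  have hstep : Primrec₂ fun (_ : List (α × Bool)) (p : (α × Bool) × List (α × Bool)) =>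
      (List.casesOn p.2 [p.1] fun hd2 tl2 =>
        if p.1.1 = hd2.1 ∧ p.1.2 = !hd2.2 then tl2 else p.1 :: hd2 :: tl2 : List (α × Bool)) := by
    have h0 : Primrec fun a : List (α × Bool) × ((α × Bool) × List (α × Bool)) => [a.2.1] :=
      list_cons.comp (fst.comp snd) (const [])
    have h1 : Primrec₂ fun (a : List (α × Bool) × ((α × Bool) × List (α × Bool)))
        (q : (α × Bool) × List (α × Bool)) =>
        if a.2.1.1 = q.1.1 ∧ a.2.1.2 = !q.1.2 then q.2 else a.2.1 :: q.1 :: q.2 :=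
      Primrec.ite hcond (snd.comp snd)
        (list_cons.comp (fst.comp (snd.comp fst))
          (list_cons.comp (fst.comp snd) (snd.comp snd)))
    exact list_casesOn (f := fun a : List (α × Bool) × ((α × Bool) × List (α × Bool)) => a.2.2)
      (snd.comp snd) h0 h1
  refine (list_foldr Primrec.id (const []) hstep).of_eq fun L => ?_
  induction L with
  | nil => rfl
  | cons a L ih =>
    rw [FreeGroup.reduce.cons, id_eq, List.foldr_cons]
    rw [id_eq] at ih
    rw [ih]

theorem Primrec.idxOf_letter :
    Primrec₂ fun (l : ℕ × Bool) (w : List (ℕ × Bool)) => w.idxOf l := by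
  have h : (instBEqProd : BEq (ℕ × Bool)) = instBEqOfDecidableEq := lawful_beq_subsingleton _ _
  rw [h]
  exact list_idxOf

theorem primrec_boundaryWord : Primrec boundaryWord := by
  refine list_flatMap list_range ?_
  have h : ∀ b c : Bool, Primrec fun p : ℕ × ℕ => (((p.2, b), c) : (ℕ × Bool) × Bool) :=
    fun b c => Primrec.pair (Primrec.pair snd (const b)) (const c)
  exact list_cons.comp (h _ _) (list_cons.comp (h _ _) (list_cons.comp (h _ _)
    (list_cons.comp (h _ _) (const []))))

theorem primrec_wordsOfLength : Primrec₂ wordsOfLength := by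
  have hletters : Primrec fun n : ℕ =>
      (List.range n).flatMap fun i => [((i, true) : ℕ × Bool), (i, false)] := by
    refine list_flatMap list_range ?_
    exact list_cons.comp (Primrec.pair snd (const true))
      (list_cons.comp (Primrec.pair snd (const false)) (const []))
  refine nat_rec (f := fun _ : ℕ => [([] : List (ℕ × Bool))])
    (g := fun (n : ℕ) (p : ℕ × List (List (ℕ × Bool))) => p.2.flatMap fun w =>
      ((List.range n).flatMap fun i => [(i, true), (i, false)]).map fun l => l :: w)
    (const _) ?_
  refine list_flatMap (snd.comp snd) ?_
  refine list_map (hletters.comp (fst.comp fst)) ?_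
  exact list_cons.comp snd (snd.comp fst)

theorem primrec_substWord : Primrec₂ substWord := by
  have hget : Primrec fun q : (List (List ((ℕ × Bool) × Bool)) × List (ℕ × Bool)) × (ℕ × Bool) =>
      q.1.1.getD q.2.1 [] := (list_getD []).comp (fst.comp fst) (fst.comp snd)
  refine list_flatMap snd ?_
  refine Primrec.cond (snd.comp snd) hget (list_reverse.comp (list_map hget ?_))
  exact Primrec.pair (fst.comp snd) (Primrec.not.comp (snd.comp snd))

theorem primrec_spellsBoundary : Primrec₂ spellsBoundary :=
  (Primrec.eq.comp (freeGroup_reduce.comp (primrec_substWord.comp (snd.comp fst) snd))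
    (freeGroup_reduce.comp (primrec_boundaryWord.comp (fst.comp fst)))).decide

theorem primrec_findWord : Primrec findWord := by
  have hW : Primrec fun a : ℕ × List (List ((ℕ × Bool) × Bool)) =>
      wordsOfLength (2 * a.1) (4 * a.1) :=
    primrec_wordsOfLength.comp (nat_mul.comp (const 2) fst) (nat_mul.comp (const 4) fst)
  exact (list_getD []).comp hW (list_findIdx hW primrec_spellsBoundary)

theorem primrec_gapStep : Primrec₂ (gapStep (α := ℕ)) := by
  have hinv : Primrec (letterInv (α := ℕ)) := Primrec.pair fst (Primrec.not.comp snd)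
  have h : Primrec fun a : List (ℕ × Bool) × ℕ =>
      (Option.casesOn a.1[a.2]? 0 fun l => a.1.idxOf (letterInv l) + 1 : ℕ) := by
    refine option_casesOn (list_getElem?.comp fst snd) (const 0) ?_
    exact succ.comp (Primrec.idxOf_letter.comp (hinv.comp snd) (fst.comp fst))
  refine h.of_eq fun a => ?_
  unfold gapStep
  cases a.1[a.2]? <;> rfl

theorem primrec_gapTrace : Primrec (gapTrace (α := ℕ)) := by
  refine list_map (list_range.comp (succ.comp list_length)) ?_
  exact nat_iterate snd (const 0) (primrec_gapStep.comp (fst.comp fst) snd)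

theorem primrec_inverseFirst : Primrec₂ (inverseFirst (α := ℕ)) := by
  have h : ∀ b : Bool, Primrec fun a : List (ℕ × Bool) × ℕ =>
      (gapTrace a.1).idxOf (a.1.idxOf (a.2, b) + 1) := fun b => by
    have h1 : Primrec fun a : List (ℕ × Bool) × ℕ => a.1.idxOf (a.2, b) + 1 :=
      succ.comp (Primrec.idxOf_letter.comp (Primrec.pair snd (const b)) fst)
    exact list_idxOf.comp h1 (primrec_gapTrace.comp fst)
  exact (nat_lt.comp (h false) (h true)).decide

theorem primrec_findInversions : Primrec findInversions :=
  list_map (list_range.comp (nat_mul.comp (const 2) fst))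
    (primrec_inverseFirst.comp (primrec_findWord.comp fst) snd)

end Primrec

theorem mem_wordsOfLength {n k : ℕ} {w : List (ℕ × Bool)} :
    w ∈ wordsOfLength n k ↔ w.length = k ∧ ∀ l ∈ w, l.1 < n := by
  induction k generalizing w with
  | zero =>
    change w ∈ [[]] ↔ _
    simp only [List.mem_singleton, List.length_eq_zero_iff]
    constructor
    · rintro rfl
      simp
    · exact fun h => h.1
  | succ k ih =>
    change w ∈ (wordsOfLength n k).flatMap _ ↔ _
    simp only [List.mem_flatMap, List.mem_map, List.mem_range, ih]
    constructor
    · rintro ⟨v, ⟨rfl, hv⟩, l, ⟨i, hi, hl⟩, rfl⟩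
      refine ⟨rfl, fun l' hl' => ?_⟩
      rcases List.mem_cons.1 hl' with rfl | hl'
      · simp only [List.mem_cons, List.not_mem_nil, or_false] at hl
        rcases hl with rfl | rfl <;> exact hi
      · exact hv _ hl'
    · rintro ⟨hk, hw⟩
      obtain _ | ⟨⟨i, b⟩, v⟩ := w
      · simp at hk
      · refine ⟨v, ⟨by simpa using hk, fun l hl => hw l (List.mem_cons_of_mem _ hl)⟩, (i, b),
          ⟨i, hw (i, b) List.mem_cons_self, ?_⟩, rfl⟩
        cases b <;> simp

/-- The embedding of the surface group into the free group on all letters with natural indices. -/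
def toNatFreeGroup (g : ℕ) : SurfaceGroup g →* FreeGroup (ℕ × Bool) :=
  FreeGroup.map fun c => (c.1.val, c.2)

theorem toNatFreeGroup_injective (g : ℕ) : Function.Injective (toNatFreeGroup g) := by
  apply FreeGroup.map_injective
  rintro ⟨i, b⟩ ⟨j, c⟩ h
  simp only [Prod.mk.injEq] at h
  exact Prod.ext (Fin.ext h.1) h.2

theorem mk_flatMap {α ι : Type*} (l : List ι) (f : ι → List (α × Bool)) :
    FreeGroup.mk (l.flatMap f) = (l.map fun i => FreeGroup.mk (f i)).prod := by
  induction l with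
  | nil => rfl
  | cons i l ih =>
    rw [List.flatMap_cons, List.map_cons, List.prod_cons, ← ih, FreeGroup.mul_mk]

theorem mk_boundaryWord (g : ℕ) :
    FreeGroup.mk (boundaryWord g) = toNatFreeGroup g (boundaryClass g) := by
  unfold boundaryWord boundaryClass
  rw [mk_flatMap, map_list_prod, List.map_map, ← List.map_coe_finRange_eq_range, List.map_map]
  congr 1

theorem mk_substWord {g : ℕ} (u : Fin (2 * g) → List ((Fin g × Bool) × Bool))
    (w : List (Fin (2 * g) × Bool)) :
    FreeGroup.mk (substWord (encodeTuple u) (w.map natLetter)) =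
      toNatFreeGroup g (FreeGroup.lift (fun i => FreeGroup.mk (u i)) (FreeGroup.mk w)) := by
  unfold substWord
  rw [mk_flatMap, FreeGroup.lift_mk, map_list_prod, List.map_map, List.map_map]
  congr 1
  apply List.map_congr_left
  rintro ⟨i, b⟩ -
  have h : (encodeTuple u).getD i.val [] = (u i).map fun l => ((l.1.1.val, l.1.2), l.2) := by
    simp [encodeTuple, List.getD_eq_getElem?_getD]
  cases b
  · simp only [Function.comp_apply, natLetter, h, cond_false, map_inv]
    rw [toNatFreeGroup, FreeGroup.map.mk, FreeGroup.inv_mk]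
    rfl
  · simp only [Function.comp_apply, natLetter, h, cond_true]
    rw [toNatFreeGroup, FreeGroup.map.mk]

/-- A word in a basis that is as short as a reduced word for the same element equals it. -/
theorem eq_of_lift_mk_eq {α γ : Type*} [Group γ] {x : α → γ}
    (hx : Function.Injective (FreeGroup.lift x)) {w w' : List (α × Bool)}
    (hw : FreeGroup.IsReduced w) (hlen : w'.length = w.length)
    (h : FreeGroup.lift x (FreeGroup.mk w') = FreeGroup.lift x (FreeGroup.mk w)) : w' = w := by
  classical
  have h1 := FreeGroup.reduce.sound (hx h)
  rw [hw.reduce_eq] at h1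
  have h2 := (FreeGroup.reduce.red (L := w')).sublist
  rw [h1] at h2
  exact (h2.eq_of_length hlen.symm).symm

/-- The search finds the right word: any word of length `4 * g` that spells the boundary class is as
short as the reduced word `w` for it, hence equals `w`. -/
theorem findWord_encodeTuple {g : ℕ} {u : Fin (2 * g) → List ((Fin g × Bool) × Bool)}
    (hx : Function.Bijective (FreeGroup.lift fun i => (FreeGroup.mk (u i) : SurfaceGroup g)))
    {w : List (Fin (2 * g) × Bool)} (hnd : w.Nodup) (hmem : ∀ l, l ∈ w)
    (hw : FreeGroup.lift (fun i => FreeGroup.mk (u i)) (FreeGroup.mk w) = boundaryClass g) :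
    findWord (g, encodeTuple u) = w.map natLetter := by
  have hlen := length_eq_of_nodup hnd hmem
  have hspell : ∀ v : List (Fin (2 * g) × Bool),
      spellsBoundary (g, encodeTuple u) (v.map natLetter) = true ↔
        FreeGroup.lift (fun i => FreeGroup.mk (u i)) (FreeGroup.mk v) = boundaryClass g := by
    intro v
    rw [← (toNatFreeGroup_injective g).eq_iff, ← mk_substWord, ← mk_boundaryWord]
    simp only [spellsBoundary, decide_eq_true_eq]
    exact ⟨FreeGroup.reduce.exact, FreeGroup.reduce.sound⟩
  have hmemW : w.map natLetter ∈ wordsOfLength (2 * g) (4 * g) := by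
    rw [mem_wordsOfLength]
    refine ⟨by simpa using hlen, ?_⟩
    intro l hl
    obtain ⟨l, -, rfl⟩ := List.mem_map.1 hl
    exact l.1.isLt
  have hlt : (wordsOfLength (2 * g) (4 * g)).findIdx (spellsBoundary (g, encodeTuple u)) <
      (wordsOfLength (2 * g) (4 * g)).length :=
    List.findIdx_lt_length_of_exists ⟨_, hmemW, (hspell w).2 hw⟩
  have hfind := List.findIdx_getElem (w := hlt)
  have hmemF := List.getElem_mem hlt
  have heq : findWord (g, encodeTuple u) = (wordsOfLength (2 * g) (4 * g))[
      (wordsOfLength (2 * g) (4 * g)).findIdx (spellsBoundary (g, encodeTuple u))]'hlt := by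
    rw [findWord, List.getD_eq_getElem?_getD, List.getElem?_eq_getElem hlt, Option.getD_some]
  rw [← heq] at hfind hmemF
  obtain ⟨hl1, hl2⟩ := mem_wordsOfLength.1 hmemF
  obtain ⟨v, hv⟩ : findWord (g, encodeTuple u) ∈
      Set.range (List.map (natLetter (n := 2 * g))) := by
    rw [Set.range_list_map]
    exact fun l hl => ⟨(⟨l.1, hl2 l hl⟩, l.2), rfl⟩
  rw [← hv] at hfind hl1 ⊢
  rw [List.length_map] at hl1
  congr 1
  exact eq_of_lift_mk_eq hx.1 (isReduced_of_lift_eq_boundaryClass hx hnd hmem hw)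
    (hl1.trans hlen.symm) (((hspell v).1 hfind).trans hw.symm)

theorem lift_bijective_of_closure_eq_top {g : ℕ} {x : Fin (2 * g) → SurfaceGroup g}
    (hx : Subgroup.closure (Set.range x) = ⊤) : Function.Bijective (FreeGroup.lift x) :=
  FreeGroup.lift_bijective_of_closure_eq_top
    (Fintype.equivOfCardEq (by simp [mul_comm])) x hx

theorem proposition6p4 :
    (∀ (g : ℕ), 1 ≤ g → ∀ x : Fin (2 * g) → SurfaceGroup g,
      Subgroup.closure (Set.range x) = ⊤ →
        ((∃ ε : Fin (2 * g) → Bool, ArisesFromFatgraph (Set.range (invertAt ε x))) ↔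
          BoundaryIsWord x) ∧
        (∀ ε ε' : Fin (2 * g) → Bool, ArisesFromFatgraph (Set.range (invertAt ε x)) →
          ArisesFromFatgraph (Set.range (invertAt ε' x)) → ε = ε')) ∧
    (∃ F : ℕ × List (List ((ℕ × Bool) × Bool)) → List Bool, Computable F ∧
      ∀ (g : ℕ), 1 ≤ g → ∀ u : Fin (2 * g) → List ((Fin g × Bool) × Bool),
        Subgroup.closure (Set.range fun i => (FreeGroup.mk (u i) : SurfaceGroup g)) = ⊤ →
          ∀ ε : Fin (2 * g) → Bool,
            ArisesFromFatgraph (Set.range (invertAt ε fun i => FreeGroup.mk (u i))) →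
              F (g, encodeTuple u) = List.ofFn ε) := by
  refine ⟨fun g hg x hgen => ⟨⟨?_, ?_⟩, ?_⟩, findInversions, primrec_findInversions.to_comp, ?_⟩
  · rintro ⟨ε, h⟩
    have hx := lift_bijective_of_closure_eq_top hgen
    obtain ⟨w, hnd, hmem, hw, -⟩ := h.exists_word hx
    exact ⟨w, isReduced_of_lift_eq_boundaryClass hx hnd hmem hw,
      fun l => List.count_eq_one_of_mem hnd (hmem l), hw⟩
  · rintro ⟨w, -, hcount, hw⟩
    refine exists_arisesFromFatgraph hg (lift_bijective_of_closure_eq_top hgen) hgen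
      (List.nodup_iff_count_le_one.2 fun l => (hcount l).le)
      (fun l => List.count_pos_iff.1 (by rw [hcount l]; exact one_pos)) hw
  · intro ε ε' h h'
    have hx := lift_bijective_of_closure_eq_top hgen
    obtain ⟨w, hnd, hmem, hw, hε⟩ := h.exists_word hx
    obtain ⟨w', hnd', hmem', hw', hε'⟩ := h'.exists_word hx
    have hww : w' = w := eq_of_lift_mk_eq hx.1
      (isReduced_of_lift_eq_boundaryClass hx hnd hmem hw)
      ((length_eq_of_nodup hnd' hmem').trans (length_eq_of_nodup hnd hmem).symm)
      (hw'.trans hw.symm)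
    funext i
    rw [hε, hε', hww]
  · intro g _ u hgen ε h
    have hx := lift_bijective_of_closure_eq_top hgen
    obtain ⟨w, hnd, hmem, hw, hε⟩ := h.exists_word hx
    rw [findInversions, findWord_encodeTuple hx hnd hmem hw]
    apply List.ext_getElem
    · simp
    · intro i h1 h2
      rw [List.getElem_map, List.getElem_range, List.getElem_ofFn, hε]
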